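/- Let $T>0$, $\lambda,\varepsilon\in\mathbb{R}$, let $U\subset\mathbb{R}^m$ be nonempty and compact, and let $f:\mathbb{R}^n\times U\to\mathbb{R}^n$ and $h:[0,T]\times\mathbb{R}^n\times U\to\mathbb{R}$ satisfy: (a) $f$ is bounded, $u\mapsto f(x,u)$ is continuous on $U$ for each $x$, and there is $L_f>0$ with $\|f(x_1,u)-f(x_2,u)\|\le L_f\|x_1-x_2\|$ for all $x_1,x_2\in\mathbb{R}^n$, $u\in U$; (b) $h$ is measurable and bounded, $u\mapsto h(t,x,u)$ is continuous on $U$ for each $(t,x)$, there is $L_h>0$ with $|h(t,x_1,u)-h(t,x_2,u)|\le L_h\|x_1-x_2\|$ for all $t\in[0,T]$, $x_1,x_2\in\mathbb{R}^n$, $u\in U$, and for every compact $K\subset\mathbb{R}^n$ $$\lim_{\delta\to0^+}\ \sup_{t\in[0,T-\delta],\ x\in K,\ u\in U}|h(t+\delta,x,u)-h(t,x,u)|=0 .$$ For $t\in[0,T]$ let $\mathcal M(t)$ be the set of measurable $u:[t,T]\to U$, and for $u\in\mathcal M(t)$ let $x^u_{t,x}$ be the (Carathéodory) solution on $[t,T]$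 of $\dot y(s)=f(y(s),u(s))$, $y(t)=x$. Put $$V_\lambda(t,x)=\inf_{u\in\mathcal M(t)}\int_t^T e^{\lambda(t-s)}h\big(s,x^u_{t,x}(s),u(s)\big)\,ds,\qquad V_\varepsilon=V_\lambda+\varepsilon,$$ $$H(t,x,p)=\inf_{u\in U}\{h(t,x,u)+p\cdot f(x,u)\}.$$ Then $V_\varepsilon$ is the unique bounded, uniformly continuous viscosity solution on $[0,T]\times\mathbb{R}^n$ of $$\partial_tV+H(t,x,\nabla_xV)-\lambda V+\lambda\varepsilon=0,\qquad V(T,\cdot)=\varepsilon. \tag{1}$$ Moreover $W_\varepsilon(\tau,x):=V_\varepsilon(T-\tau,x)$ is the unique bounded, uniformly continuous viscosity solution on $[0,T]\times\mathbb{R}^n$ of the forward problem $$\partial_\tau W=H(T-\tau,x,\nabla_xW)-\lambda W+\lambda\varepsilon,\qquad W(0,\cdot)=\varepsilon. \tag{2}$$ Here $V$ is a viscosity solution of (1) if $V(T,\cdot)=\varepsilon$ and, for every $\phi\in C^1$ and every $(t_0,x_0)$ with $t_0\in I$, one has $\partial_t\phi+H(t_0,x_0,\nabla_x\phi)-\lambda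 V+\lambda\varepsilon\ge0$ at $(t_0,x_0)$ whenever $V-\phi$ has a local maximum there relative to $[0,T]\times\mathbb{R}^n$, and $\le 0$ whenever it has a local minimum there. Likewise $W$ is a viscosity solution of (2) if $W(0,\cdot)=\varepsilon$ and, for every $\phi\in C^1$ and every $(\tau_0,x_0)$ with $\tau_0\in I$, one has $\partial_\tau\phi-H(T-\tau_0,x_0,\nabla_x\phi)+\lambda W-\lambda\varepsilon\le0$ at $(\tau_0,x_0)$ at local maxima of $W-\phi$, and $\ge0$ at local minima. The results hold for both usual choices of the set $I$ of times at which the equation is tested: $I=(0,T)$, or $I=[0,T)$ for (1) and $I=(0,T]$ for (2). -/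

import Mathlib

open Set MeasureTheory

noncomputable section

namespace ShiftedHJB

variable {n m : ℕ}

/-- Standing assumptions on the horizon `T`, the control set `U ⊆ ℝᵐ`, the dynamics `f` and the
running cost `h`. The functions `f` and `h` only matter on `ℝⁿ × U` and `[0,T] × ℝⁿ × U`. -/
structure StandingAssumptions (T : ℝ) (U : Set (EuclideanSpace ℝ (Fin m)))
    (f : EuclideanSpace ℝ (Fin n) → EuclideanSpace ℝ (Fin m) → EuclideanSpace ℝ (Fin n))
    (h : ℝ → EuclideanSpace ℝ (Fin n) → EuclideanSpace ℝ (Fin m) → ℝ) : Prop where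
  horizon_pos : 0 < T
  control_nonempty : U.Nonempty
  control_compact : IsCompact U
  dyn_lipschitz : ∃ L : ℝ, 0 < L ∧ ∀ x₁ x₂, ∀ u ∈ U, ‖f x₁ u - f x₂ u‖ ≤ L * ‖x₁ - x₂‖
  dyn_bounded : ∃ M : ℝ, 0 < M ∧ ∀ x, ∀ u ∈ U, ‖f x u‖ ≤ M
  dyn_continuous : ∀ x, ContinuousOn (fun u => f x u) U
  cost_measurable : Measurable
    (fun p : Icc (0 : ℝ) T × EuclideanSpace ℝ (Fin n) × U => h p.1 p.2.1 p.2.2)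
  cost_lipschitz : ∃ L : ℝ, 0 < L ∧ ∀ t ∈ Icc 0 T, ∀ x₁ x₂, ∀ u ∈ U,
    |h t x₁ u - h t x₂ u| ≤ L * ‖x₁ - x₂‖
  cost_bounded : ∃ M : ℝ, 0 < M ∧ ∀ t ∈ Icc 0 T, ∀ x, ∀ u ∈ U, |h t x u| ≤ M
  cost_continuous : ∀ t ∈ Icc 0 T, ∀ x, ContinuousOn (fun u => h t x u) U
  /-- For compact `K`, the supremum of `|h (t + δ) x u - h t x u|` over `t ∈ [0, T - δ]`, `x ∈ K`,
  `u ∈ U` tends to `0` as `δ → 0⁺`. -/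
  cost_time_regular : ∀ K : Set (EuclideanSpace ℝ (Fin n)), IsCompact K → ∀ η > 0, ∃ δ₀ > 0,
    ∀ δ ∈ Ioo 0 δ₀, ∀ t ∈ Icc 0 (T - δ), ∀ x ∈ K, ∀ u ∈ U, |h (t + δ) x u - h t x u| ≤ η

/-- Admissible controls: measurable maps `[t,T] → U`, represented by functions on `ℝ` whose values
off `[t,T]` are irrelevant. -/
def IsAdmissible (T : ℝ) (U : Set (EuclideanSpace ℝ (Fin m))) (t : ℝ)
    (u : ℝ → EuclideanSpace ℝ (Fin m)) : Prop :=
  Measurable (fun s : Icc t T => u s) ∧ ∀ s ∈ Icc t T, u s ∈ U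

/-- `y` is the (Carathéodory) solution on `[t,T]` of `y' = f(y,u)`, `y(t) = x`. -/
def IsTrajectory (T : ℝ)
    (f : EuclideanSpace ℝ (Fin n) → EuclideanSpace ℝ (Fin m) → EuclideanSpace ℝ (Fin n))
    (t : ℝ) (x : EuclideanSpace ℝ (Fin n)) (u : ℝ → EuclideanSpace ℝ (Fin m))
    (y : ℝ → EuclideanSpace ℝ (Fin n)) : Prop :=
  ContinuousOn y (Icc t T) ∧
    ∀ s ∈ Icc t T,
      IntervalIntegrable (fun r => f (y r) (u r)) volume t s ∧
      y s = x + ∫ r in t..s, f (y r) (u r)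

/-- The cost `∫_t^T e^{λ(t-s)} h(s, y(s), u(s)) ds`. -/
def discountedCost (T lam : ℝ)
    (h : ℝ → EuclideanSpace ℝ (Fin n) → EuclideanSpace ℝ (Fin m) → ℝ)
    (t : ℝ) (u : ℝ → EuclideanSpace ℝ (Fin m)) (y : ℝ → EuclideanSpace ℝ (Fin n)) : ℝ :=
  ∫ s in t..T, Real.exp (lam * (t - s)) * h s (y s) (u s)

/-- The discounted value `V_λ(t,x)`. -/
def discountedValue (T lam : ℝ) (U : Set (EuclideanSpace ℝ (Fin m)))
    (f : EuclideanSpace ℝ (Fin n) → EuclideanSpace ℝ (Fin m) → EuclideanSpace ℝ (Fin n))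
    (h : ℝ → EuclideanSpace ℝ (Fin n) → EuclideanSpace ℝ (Fin m) → ℝ)
    (t : ℝ) (x : EuclideanSpace ℝ (Fin n)) : ℝ :=
  sInf {J : ℝ | ∃ u y, IsAdmissible T U t u ∧ IsTrajectory T f t x u y ∧
    J = discountedCost T lam h t u y}

/-- The shifted value `V_ε = V_λ + ε`. -/
def shiftedValue (T lam ε : ℝ) (U : Set (EuclideanSpace ℝ (Fin m)))
    (f : EuclideanSpace ℝ (Fin n) → EuclideanSpace ℝ (Fin m) → EuclideanSpace ℝ (Fin n))
    (h : ℝ → EuclideanSpace ℝ (Fin n) → EuclideanSpace ℝ (Fin m) → ℝ)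
    (t : ℝ) (x : EuclideanSpace ℝ (Fin n)) : ℝ :=
  discountedValue T lam U f h t x + ε

/-- The Hamiltonian `H(t,x,p) = inf_{u ∈ U} (h(t,x,u) + p · f(x,u))`. -/
def hamiltonian (U : Set (EuclideanSpace ℝ (Fin m)))
    (f : EuclideanSpace ℝ (Fin n) → EuclideanSpace ℝ (Fin m) → EuclideanSpace ℝ (Fin n))
    (h : ℝ → EuclideanSpace ℝ (Fin n) → EuclideanSpace ℝ (Fin m) → ℝ)
    (t : ℝ) (x p : EuclideanSpace ℝ (Fin n)) : ℝ :=
  ⨅ u : U, (h t x u + inner ℝ p (f x u))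

/-- `V` is bounded and uniformly continuous on `[0,T] × ℝⁿ`. -/
def IsBUC (T : ℝ) (V : ℝ → EuclideanSpace ℝ (Fin n) → ℝ) : Prop :=
  (∃ C : ℝ, ∀ t ∈ Icc 0 T, ∀ x, |V t x| ≤ C) ∧
    UniformContinuousOn (fun p : ℝ × EuclideanSpace ℝ (Fin n) => V p.1 p.2) (Icc 0 T ×ˢ univ)

/-- `V` is a viscosity solution of the terminal value problem
`∂_t V + H(t,x,∇V) - λ V + λ ε = 0`, `V(T,·) = ε`.
The equation is tested at the points of `I × ℝⁿ`, with extrema of `V - φ` local relative to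
`[0,T] × ℝⁿ`. -/
structure IsViscositySolutionTerminal (T lam ε : ℝ)
    (H : ℝ → EuclideanSpace ℝ (Fin n) → EuclideanSpace ℝ (Fin n) → ℝ) (I : Set ℝ)
    (V : ℝ → EuclideanSpace ℝ (Fin n) → ℝ) : Prop where
  terminal : ∀ x, V T x = ε
  subsolution : ∀ φ : ℝ × EuclideanSpace ℝ (Fin n) → ℝ, ContDiff ℝ 1 φ → ∀ t ∈ I, ∀ x,
    IsLocalMaxOn (fun p => V p.1 p.2 - φ p) (Icc 0 T ×ˢ univ) (t, x) →
    0 ≤ deriv (fun s => φ (s, x)) t + H t x (gradient (fun y => φ (t, y)) x)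
      - lam * V t x + lam * ε
  supersolution : ∀ φ : ℝ × EuclideanSpace ℝ (Fin n) → ℝ, ContDiff ℝ 1 φ → ∀ t ∈ I, ∀ x,
    IsLocalMinOn (fun p => V p.1 p.2 - φ p) (Icc 0 T ×ˢ univ) (t, x) →
    deriv (fun s => φ (s, x)) t + H t x (gradient (fun y => φ (t, y)) x)
      - lam * V t x + lam * ε ≤ 0

/-- `W` is a viscosity solution of the initial value problem
`∂_τ W = H(τ,x,∇W) - λ W + λ ε`, `W(0,·) = ε`, that is, of `∂_τ W - H(τ,x,∇W) + λ W - λ ε = 0`,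
tested at the points of `I × ℝⁿ`. -/
structure IsViscositySolutionInitial (T lam ε : ℝ)
    (H : ℝ → EuclideanSpace ℝ (Fin n) → EuclideanSpace ℝ (Fin n) → ℝ) (I : Set ℝ)
    (W : ℝ → EuclideanSpace ℝ (Fin n) → ℝ) : Prop where
  initial : ∀ x, W 0 x = ε
  subsolution : ∀ φ : ℝ × EuclideanSpace ℝ (Fin n) → ℝ, ContDiff ℝ 1 φ → ∀ τ ∈ I, ∀ x,
    IsLocalMaxOn (fun p => W p.1 p.2 - φ p) (Icc 0 T ×ˢ univ) (τ, x) →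
    deriv (fun s => φ (s, x)) τ
      ≤ H τ x (gradient (fun y => φ (τ, y)) x) - lam * W τ x + lam * ε
  supersolution : ∀ φ : ℝ × EuclideanSpace ℝ (Fin n) → ℝ, ContDiff ℝ 1 φ → ∀ τ ∈ I, ∀ x,
    IsLocalMinOn (fun p => W p.1 p.2 - φ p) (Icc 0 T ×ˢ univ) (τ, x) →
    H τ x (gradient (fun y => φ (τ, y)) x) - lam * W τ x + lam * ε
      ≤ deriv (fun s => φ (s, x)) τ

end ShiftedHJB

end

/-! Since e^{λ(t-s)} = e^{λt} e^{-λs}, the function e^{-λt} V_λ is the value of a problem without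
discount and with running cost e^{-λs} h (`mildValue_eq`). On the side of the equation, V ↦
e^{-λt}(V - ε) turns solutions of (1) into solutions with λ = ε = 0
(`IsViscositySolutionTerminal.exp_mul`). Both existence and uniqueness thus reduce to an
undiscounted problem with zero terminal value.

For that problem the bounded speed of trajectories and Grönwall's inequality make the value
Lipschitz. The viscosity inequalities come from dynamic programming over a short time, combined with
a first-order expansion whose error is uniform in the control (`exists_forall_abs_expansion_le`):
constant controls give the subsolution property, nearly optimal ones the supersolution property.
Only times after t enter, so the equation may also be tested at t = 0.

Uniqueness is comparison by doubling of variables (`le_of_isViscositySolutionTerminal`). A barrier N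
e^{-kt}, too large at time 0 for a maximum to sit there yet negligible at the point to be
contradicted, keeps maxima off time 0 and makes the inequality strict. Interior times therefore
suffice for uniqueness. With existence on the larger test set and uniqueness on the smaller one,
both conventions follow, and τ = T - t carries everything to the forward problem. -/

noncomputable section

namespace ShiftedHJB

set_option linter.unusedSectionVars false

/-! ### Existence, stability and concatenation of trajectories -/

section Trajectories

variable {E A : Type*} [NormedAddCommGroup E] [InnerProductSpace ℝ E] [FiniteDimensional ℝ E]
  [MeasurableSpace E] [BorelSpace E] [MeasurableSpace A]

/-- An undiscounted control problem with dynamics `F` and running cost `G`, both bounded by `M`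
and `L`-Lipschitz in the state, and with `G` continuous in time, locally uniformly in the state. -/
structure IsControlSystem (F : E → A → E) (G : ℝ → E → A → ℝ) (M L : ℝ) : Prop where
  dyn_measurable : Measurable (Function.uncurry F)
  dyn_bounded : ∀ x a, ‖F x a‖ ≤ M
  dyn_lipschitz : ∀ x y a, ‖F x a - F y a‖ ≤ L * ‖x - y‖
  cost_measurable : Measurable fun p : ℝ × E × A => G p.1 p.2.1 p.2.2
  cost_bounded : ∀ t x a, |G t x a| ≤ M
  cost_lipschitz : ∀ t x y a, |G t x a - G t y a| ≤ L * ‖x - y‖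
  cost_time : ∀ K : Set E, IsCompact K → ∀ η > 0, ∃ δ > 0, ∀ s t, |s - t| < δ →
    ∀ x ∈ K, ∀ a, |G s x a - G t x a| ≤ η
  bound_nonneg : 0 ≤ M
  lipschitz_nonneg : 0 ≤ L

/-- `y` is continuous and solves the integral equation `y' = F(y,u)`, `y(t) = x` on `[t,T]`. -/
def IsMildTrajectory (F : E → A → E) (t T : ℝ) (x : E) (u : ℝ → A) (y : ℝ → E) : Prop :=
  Continuous y ∧ ∀ s ∈ Icc t T, y s = x + ∫ r in t..s, F (y r) (u r)

variable {F : E → A → E} {G : ℝ → E → A → ℝ} {M L t T : ℝ} {x : E} {u : ℝ → A} {y : ℝ → E}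

lemma intervalIntegrable_of_measurable_of_norm_le {X : Type*} [NormedAddCommGroup X]
    [MeasurableSpace X] [BorelSpace X] [SecondCountableTopology X] {g : ℝ → X}
    (hg : Measurable g) {C : ℝ} (hC : ∀ r, ‖g r‖ ≤ C) (a b : ℝ) :
    IntervalIntegrable g volume a b :=
  (intervalIntegrable_const (c := C)).mono_fun hg.aestronglyMeasurable
    (Filter.Eventually.of_forall fun r => (hC r).trans (le_abs_self C))

namespace IsControlSystem

lemma dyn_intervalIntegrable (hS : IsControlSystem F G M L) (hu : Measurable u)
    (hy : Continuous y) (a b : ℝ) :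
    IntervalIntegrable (fun r => F (y r) (u r)) volume a b :=
  intervalIntegrable_of_measurable_of_norm_le
    (hS.dyn_measurable.comp (hy.measurable.prodMk hu)) (fun _ => hS.dyn_bounded _ _) a b

lemma cost_intervalIntegrable (hS : IsControlSystem F G M L) (hu : Measurable u)
    (hy : Continuous y) (a b : ℝ) :
    IntervalIntegrable (fun r => G r (y r) (u r)) volume a b :=
  intervalIntegrable_of_measurable_of_norm_le
    (hS.cost_measurable.comp (measurable_id.prodMk (hy.measurable.prodMk hu)))
    (fun _ => hS.cost_bounded _ _ _) a b

/-- The Picard operator `z ↦ x + ∫_t^· F(z,u)` on continuous curves on `[t,T]`. -/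
def picardMap (hS : IsControlSystem F G M L) (htT : t ≤ T) (hu : Measurable u) (x : E)
    (z : C(Icc t T, E)) : C(Icc t T, E) where
  toFun s := x + ∫ r in t..s, F (z (projIcc t T htT r)) (u r)
  continuous_toFun := by
    have := intervalIntegral.continuous_primitive
      (hS.dyn_intervalIntegrable hu (z.continuous.comp (continuous_projIcc (h := htT)))) t
    exact continuous_const.add (this.comp continuous_subtype_val)

/-- Each application integrates the previous bound once more, which produces the factorial. Some
iterate is then a contraction however long the horizon is. -/
lemma dist_iterate_picardMap_apply_le (hS : IsControlSystem F G M L) (htT : t ≤ T)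
    (hu : Measurable u) (x : E) (z w : C(Icc t T, E)) (k : ℕ) (s : Icc t T) :
    dist ((hS.picardMap htT hu x)^[k] z s) ((hS.picardMap htT hu x)^[k] w s) ≤
      (L * (s - t)) ^ k / k.factorial * dist z w := by
  induction k generalizing s with
  | zero => simpa using ContinuousMap.dist_apply_le_dist s
  | succ k ih =>
    have hi (z : C(Icc t T, E)) :
        IntervalIntegrable (fun r => F (z (projIcc t T htT r)) (u r)) volume t s :=
      hS.dyn_intervalIntegrable hu (z.continuous.comp (continuous_projIcc (h := htT))) t s
    have hL := hS.lipschitz_nonneg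
    rw [Function.iterate_succ_apply', Function.iterate_succ_apply', dist_eq_norm]
    set z' := (hS.picardMap htT hu x)^[k] z
    set w' := (hS.picardMap htT hu x)^[k] w
    change ‖(x + ∫ r in t..s, F (z' (projIcc t T htT r)) (u r)) -
      (x + ∫ r in t..s, F (w' (projIcc t T htT r)) (u r))‖ ≤ _
    rw [add_sub_add_left_eq_sub, ← intervalIntegral.integral_sub (hi z') (hi w')]
    calc _ ≤ ∫ r in t..s, L ^ (k + 1) * dist z w / k.factorial * (r - t) ^ k := by
          refine intervalIntegral.norm_integral_le_of_norm_le s.2.1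
            (Filter.Eventually.of_forall fun r hr => ?_)
            (Continuous.intervalIntegrable (by fun_prop) _ _)
          have hr' : r ∈ Icc t T := ⟨hr.1.le, hr.2.trans s.2.2⟩
          refine (hS.dyn_lipschitz _ _ _).trans ?_
          rw [projIcc_of_mem htT hr', ← dist_eq_norm]
          refine (mul_le_mul_of_nonneg_left (ih ⟨r, hr'⟩) hL).trans (le_of_eq ?_)
          simp only [mul_pow]
          ring
      _ = _ := by
          rw [intervalIntegral.integral_const_mul,
            intervalIntegral.integral_comp_sub_right (fun r => r ^ k) t, integral_pow,
            Nat.factorial_succ, sub_self, zero_pow (Nat.succ_ne_zero k), sub_zero, mul_pow]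
          push_cast
          field_simp

/-- Measurable controls have trajectories. -/
theorem exists_isMildTrajectory (hS : IsControlSystem F G M L) (htT : t ≤ T)
    (hu : Measurable u) (x : E) : ∃ y, IsMildTrajectory F t T x u y := by
  have hL := hS.lipschitz_nonneg
  obtain ⟨k, hk⟩ := (FloorSemiring.tendsto_pow_div_factorial_atTop (L * (T - t))).eventually
    (gt_mem_nhds zero_lt_one) |>.exists
  have hk0 : 0 ≤ (L * (T - t)) ^ k / k.factorial := by
    have := sub_nonneg.2 htT
    positivity
  have hc : ContractingWith ⟨_, hk0⟩ (hS.picardMap htT hu x)^[k] := by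
    refine ⟨hk, LipschitzWith.of_dist_le_mul fun z w => ?_⟩
    refine (ContinuousMap.dist_le (by positivity)).2 fun s => ?_
    refine (hS.dist_iterate_picardMap_apply_le htT hu x z w k s).trans ?_
    have h1 := s.2.1
    have h2 := s.2.2
    have : 0 ≤ (s : ℝ) - t := sub_nonneg.2 h1
    change _ ≤ (L * (T - t)) ^ k / k.factorial * dist z w
    gcongr
  have hz := hc.isFixedPt_fixedPoint_iterate
  set z := hc.fixedPoint
  refine ⟨fun s => z (projIcc t T htT s), z.continuous.comp continuous_projIcc, fun s hs => ?_⟩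
  change z (projIcc t T htT s) = _
  rw [projIcc_of_mem htT hs]
  exact (DFunLike.congr_fun hz.eq ⟨s, hs⟩).symm

end IsControlSystem

/-- Grönwall's inequality in integral form. -/
lemma le_mul_exp_of_le_add_integral {g : ℝ → ℝ} (hg : Continuous g) {a : ℝ} (hL : 0 ≤ L)
    (h : ∀ s ∈ Icc t T, g s ≤ a + L * ∫ r in t..s, g r) :
    ∀ s ∈ Icc t T, g s ≤ a * Real.exp (L * (s - t)) := by
  have hd : ∀ s, HasDerivAt (fun s => a + L * ∫ r in t..s, g r) (L * g s) s := fun s =>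
    ((hg.integral_hasStrictDerivAt t s).hasDerivAt.const_mul L).const_add a
  -- The majorant a + L ∫ g has derivative L g, which the hypothesis bounds by L times the majorant
  -- itself.
  have key : ∀ s ∈ Icc t T, a + L * ∫ r in t..s, g r ≤ gronwallBound a L 0 (s - t) := by
    refine le_gronwallBound_of_liminf_deriv_right_le (f' := fun s => L * g s)
      (fun s _ => (hd s).continuousAt.continuousWithinAt)
      (fun s _ r hr => (hd s).hasDerivWithinAt.liminf_right_slope_le hr) (by simp) ?_
    intro s hs
    simpa using mul_le_mul_of_nonneg_left (h s ⟨hs.1, hs.2.le⟩) hL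
  intro s hs
  simpa [gronwallBound_ε0] using (h s hs).trans (key s hs)

namespace IsMildTrajectory

lemma initial (hy : IsMildTrajectory F t T x u y) (htT : t ≤ T) : y t = x := by
  simpa using hy.2 t ⟨le_rfl, htT⟩

lemma norm_sub_le (hS : IsControlSystem F G M L)
    (hy : IsMildTrajectory F t T x u y) {s : ℝ} (hs : s ∈ Icc t T) : ‖y s - x‖ ≤ M * (s - t) := by
  rw [hy.2 s hs, add_sub_cancel_left, ← abs_of_nonneg (sub_nonneg.2 hs.1)]
  exact intervalIntegral.norm_integral_le_of_norm_le_const fun r _ => hS.dyn_bounded _ _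

lemma dist_le (hS : IsControlSystem F G M L) (hu : Measurable u) {x' : E} {y' : ℝ → E}
    (hy : IsMildTrajectory F t T x u y) (hy' : IsMildTrajectory F t T x' u y') :
    ∀ s ∈ Icc t T, ‖y s - y' s‖ ≤ ‖x - x'‖ * Real.exp (L * (s - t)) := by
  refine le_mul_exp_of_le_add_integral (hy.1.sub hy'.1).norm hS.lipschitz_nonneg fun s hs => ?_
  simp only [Pi.sub_apply]
  have h1 := hS.dyn_intervalIntegrable hu hy.1 t s
  have h2 := hS.dyn_intervalIntegrable hu hy'.1 t s
  rw [hy.2 s hs, hy'.2 s hs, add_sub_add_comm, ← intervalIntegral.integral_sub h1 h2,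
    ← intervalIntegral.integral_const_mul]
  refine (norm_add_le _ _).trans (add_le_add_right ?_ _)
  exact intervalIntegral.norm_integral_le_of_norm_le hs.1
    (Filter.Eventually.of_forall fun r _ => hS.dyn_lipschitz _ _ _)
    (((hy.1.sub hy'.1).norm.const_mul L).intervalIntegrable _ _)

lemma restrict (hS : IsControlSystem F G M L) (hu : Measurable u)
    (hy : IsMildTrajectory F t T x u y) {s : ℝ} (hs : s ∈ Icc t T) :
    IsMildTrajectory F s T (y s) u y := by
  refine ⟨hy.1, fun r hr => ?_⟩
  rw [hy.2 r ⟨hs.1.trans hr.1, hr.2⟩, hy.2 s hs, add_assoc,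
    intervalIntegral.integral_add_adjacent_intervals (hS.dyn_intervalIntegrable hu hy.1 _ _)
      (hS.dyn_intervalIntegrable hu hy.1 _ _)]

/-- Following `u` up to time `s` and `u'` afterwards. -/
lemma concat (hS : IsControlSystem F G M L) (hu : Measurable u)
    {u' : ℝ → A} {y' : ℝ → E} (hu' : Measurable u') (hy : IsMildTrajectory F t T x u y) {s : ℝ}
    (hs : s ∈ Icc t T) (hy' : IsMildTrajectory F s T (y s) u' y') :
    Measurable (fun r => if r ≤ s then u r else u' r) ∧
      IsMildTrajectory F t T x (fun r => if r ≤ s then u r else u' r)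
        (fun r => if r ≤ s then y r else y' r) := by
  have hum : Measurable (fun r => if r ≤ s then u r else u' r) :=
    Measurable.ite measurableSet_Iic hu hu'
  have hyc : Continuous (fun r => if r ≤ s then y r else y' r) := by
    refine Continuous.if_le hy.1 hy'.1 continuous_id continuous_const ?_
    rintro r rfl
    exact (hy'.initial hs.2).symm
  have hleft : ∀ r ≤ s, t ≤ r → ∫ q in t..r, F (if q ≤ s then y q else y' q)
      (if q ≤ s then u q else u' q) = ∫ q in t..r, F (y q) (u q) := by
    intro r hr htr
    refine intervalIntegral.integral_congr fun q hq => ?_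
    rw [uIcc_of_le htr] at hq
    simp [hq.2.trans hr]
  refine ⟨hum, hyc, fun r hr => ?_⟩
  by_cases hrs : r ≤ s
  · simp only [hrs, if_true]
    rw [hleft r hrs hr.1, hy.2 r hr]
  · simp only [hrs, if_false]
    push Not at hrs
    rw [← intervalIntegral.integral_add_adjacent_intervals
      (hS.dyn_intervalIntegrable hum hyc t s) (hS.dyn_intervalIntegrable hum hyc s r),
      hleft s le_rfl hs.1, hy'.2 r ⟨hrs.le, hr.2⟩, hy.2 s hs, add_assoc]
    congr 2
    -- The half-open interval matters: at q = s the glued control still takes the value of `u`.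
    refine intervalIntegral.integral_congr_ae (Filter.Eventually.of_forall fun q hq => ?_)
    rw [uIoc_of_le hrs.le] at hq
    simp [not_le.2 hq.1]

end IsMildTrajectory

end Trajectories

/-! ### Dynamic programming and Lipschitz estimates for the value -/

section Value

variable {E A : Type*} [NormedAddCommGroup E] [InnerProductSpace ℝ E] [FiniteDimensional ℝ E]
  [MeasurableSpace E] [BorelSpace E] [MeasurableSpace A]

/-- The undiscounted value function. -/
def mildValue (F : E → A → E) (G : ℝ → E → A → ℝ) (T t : ℝ) (x : E) : ℝ :=
  sInf {J : ℝ | ∃ u y, Measurable u ∧ IsMildTrajectory F t T x u y ∧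
    J = ∫ s in t..T, G s (y s) (u s)}

variable {F : E → A → E} {G : ℝ → E → A → ℝ} {M L t T : ℝ} {x : E} {u : ℝ → A} {y : ℝ → E}

namespace IsControlSystem

lemma abs_integral_cost_le (hS : IsControlSystem F G M L) {a b : ℝ} (hab : a ≤ b)
    (u : ℝ → A) (y : ℝ → E) : |∫ s in a..b, G s (y s) (u s)| ≤ M * (b - a) := by
  rw [← abs_of_nonneg (sub_nonneg.2 hab), ← Real.norm_eq_abs (∫ s in a..b, G s (y s) (u s))]
  exact intervalIntegral.norm_integral_le_of_norm_le_const fun r _ => hS.cost_bounded _ _ _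

lemma mildValue_le (hS : IsControlSystem F G M L) (htT : t ≤ T) (hu : Measurable u)
    (hy : IsMildTrajectory F t T x u y) : mildValue F G T t x ≤ ∫ s in t..T, G s (y s) (u s) := by
  refine csInf_le ⟨-(M * (T - t)), ?_⟩ ⟨u, y, hu, hy, rfl⟩
  rintro J ⟨u, y, -, -, rfl⟩
  exact (abs_le.1 (hS.abs_integral_cost_le htT u y)).1

variable [Nonempty A]

lemma exists_cost_lt (hS : IsControlSystem F G M L) (htT : t ≤ T) (x : E) {η : ℝ} (hη : 0 < η) :
    ∃ u y, Measurable u ∧ IsMildTrajectory F t T x u y ∧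
      ∫ s in t..T, G s (y s) (u s) < mildValue F G T t x + η := by
  have hne : {J : ℝ | ∃ u y, Measurable u ∧ IsMildTrajectory F t T x u y ∧
      J = ∫ s in t..T, G s (y s) (u s)}.Nonempty := by
    -- A constant control shows that the infimum is not the default value of an empty set.
    obtain ⟨a⟩ := ‹Nonempty A›
    obtain ⟨y, hy⟩ := hS.exists_isMildTrajectory htT (measurable_const (a := a)) x
    exact ⟨_, _, y, measurable_const, hy, rfl⟩
  obtain ⟨J, ⟨u, y, hu, hy, rfl⟩, hJ⟩ :=
    exists_lt_of_csInf_lt hne (lt_add_of_pos_right (mildValue F G T t x) hη)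
  exact ⟨u, y, hu, hy, hJ⟩

lemma abs_mildValue_le (hS : IsControlSystem F G M L) (htT : t ≤ T) (x : E) :
    |mildValue F G T t x| ≤ M * (T - t) := by
  refine abs_le.2 ⟨le_of_forall_pos_le_add fun η hη => ?_, le_of_forall_pos_le_add fun η hη => ?_⟩
  all_goals
    obtain ⟨u, y, hu, hy, hJ⟩ := hS.exists_cost_lt htT x hη
    have h1 := abs_le.1 (hS.abs_integral_cost_le htT u y)
    have h2 := hS.mildValue_le htT hu hy
    linarith

/-- Dynamic programming: no control beats the value. -/
lemma mildValue_le_integral_add (hS : IsControlSystem F G M L) (hu : Measurable u)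
    (hy : IsMildTrajectory F t T x u y) {s : ℝ} (hs : s ∈ Icc t T) :
    mildValue F G T t x ≤ (∫ r in t..s, G r (y r) (u r)) + mildValue F G T s (y s) := by
  refine le_of_forall_pos_le_add fun η hη => ?_
  obtain ⟨u', y', hu', hy', hJ⟩ := hS.exists_cost_lt hs.2 (y s) hη
  obtain ⟨hum, hyt⟩ := hy.concat hS hu hu' hs hy'
  have h1 := hS.mildValue_le (hs.1.trans hs.2) hum hyt
  rw [← intervalIntegral.integral_add_adjacent_intervals
    (hS.cost_intervalIntegrable hum hyt.1 t s) (hS.cost_intervalIntegrable hum hyt.1 s T)] at h1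
  have h2 : ∫ r in t..s, G r (if r ≤ s then y r else y' r) (if r ≤ s then u r else u' r) =
      ∫ r in t..s, G r (y r) (u r) := by
    refine intervalIntegral.integral_congr fun q hq => ?_
    rw [uIcc_of_le hs.1] at hq
    simp [hq.2]
  have h3 : ∫ r in s..T, G r (if r ≤ s then y r else y' r) (if r ≤ s then u r else u' r) =
      ∫ r in s..T, G r (y' r) (u' r) := by
    refine intervalIntegral.integral_congr_ae (Filter.Eventually.of_forall fun q hq => ?_)
    rw [uIoc_of_le hs.2] at hq
    simp [not_le.2 hq.1]
  linarith

/-- Dynamic programming: the value is nearly attained, along the whole trajectory. -/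
lemma exists_integral_add_le (hS : IsControlSystem F G M L) (htT : t ≤ T) (x : E) {η : ℝ}
    (hη : 0 < η) :
    ∃ u y, Measurable u ∧ IsMildTrajectory F t T x u y ∧ ∀ s ∈ Icc t T,
      (∫ r in t..s, G r (y r) (u r)) + mildValue F G T s (y s) ≤ mildValue F G T t x + η := by
  obtain ⟨u, y, hu, hy, hJ⟩ := hS.exists_cost_lt htT x hη
  refine ⟨u, y, hu, hy, fun s hs => ?_⟩
  have h1 := hS.mildValue_le hs.2 hu (hy.restrict hS hu hs)
  rw [← intervalIntegral.integral_add_adjacent_intervals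
    (hS.cost_intervalIntegrable hu hy.1 t s) (hS.cost_intervalIntegrable hu hy.1 s T)] at hJ
  linarith

/-- A control nearly optimal from x' is also run from x; Grönwall keeps the two trajectories within
e^{LT}‖x - x'‖ of each other. -/
lemma mildValue_sub_le (hS : IsControlSystem F G M L) (ht : t ∈ Icc 0 T) (x x' : E) :
    mildValue F G T t x - mildValue F G T t x' ≤ L * Real.exp (L * T) * T * ‖x - x'‖ := by
  refine sub_le_iff_le_add.2 (le_of_forall_pos_le_add fun η hη => ?_)
  have hL := hS.lipschitz_nonneg
  obtain ⟨u, y', hu, hy', hJ⟩ := hS.exists_cost_lt ht.2 x' hη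
  obtain ⟨y, hy⟩ := hS.exists_isMildTrajectory ht.2 hu x
  have h1 := hS.mildValue_le ht.2 hu hy
  have hc := hS.cost_intervalIntegrable hu hy.1 t T
  have hc' := hS.cost_intervalIntegrable hu hy'.1 t T
  have h2 : ‖∫ s in t..T, (G s (y s) (u s) - G s (y' s) (u s))‖ ≤
      L * (‖x - x'‖ * Real.exp (L * T)) * |T - t| := by
    refine intervalIntegral.norm_integral_le_of_norm_le_const fun s hs => ?_
    rw [uIoc_of_le ht.2] at hs
    refine (hS.cost_lipschitz _ _ _ _).trans (mul_le_mul_of_nonneg_left ?_ hL)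
    refine (hy.dist_le hS hu hy' s ⟨hs.1.le, hs.2⟩).trans ?_
    have := hs.2
    have := ht.1
    gcongr
    linarith
  rw [intervalIntegral.integral_sub hc hc', abs_of_nonneg (sub_nonneg.2 ht.2)] at h2
  have h3 : L * (‖x - x'‖ * Real.exp (L * T)) * (T - t) ≤ L * Real.exp (L * T) * T * ‖x - x'‖ := by
    have : L * (‖x - x'‖ * Real.exp (L * T)) * (T - t) ≤
        L * (‖x - x'‖ * Real.exp (L * T)) * T := by
      gcongr
      linarith [ht.1]
    linarith
  have h4 := le_abs_self ((∫ s in t..T, G s (y s) (u s)) - ∫ s in t..T, G s (y' s) (u s))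
  rw [Real.norm_eq_abs] at h2
  linarith

lemma abs_mildValue_sub_le (hS : IsControlSystem F G M L) (ht : t ∈ Icc 0 T) (x x' : E) :
    |mildValue F G T t x - mildValue F G T t x'| ≤ L * Real.exp (L * T) * T * ‖x - x'‖ := by
  refine abs_sub_le_iff.2 ⟨hS.mildValue_sub_le ht x x', ?_⟩
  rw [norm_sub_rev]
  exact hS.mildValue_sub_le ht x' x

/-- By dynamic programming the two values differ by a running cost, at most M(s - t), and by the
effect of a displacement of the state by at most M(s - t). -/
lemma abs_mildValue_sub_le_time (hS : IsControlSystem F G M L) {s : ℝ} (ht : 0 ≤ t)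
    (hs : s ∈ Icc t T) (x : E) :
    |mildValue F G T t x - mildValue F G T s x| ≤
      (M + L * Real.exp (L * T) * T * M) * (s - t) := by
  have hs0 : s ∈ Icc 0 T := ⟨ht.trans hs.1, hs.2⟩
  have hL := hS.lipschitz_nonneg
  have key : ∀ u y, IsMildTrajectory F t T x u y →
      |∫ r in t..s, G r (y r) (u r)| + |mildValue F G T s (y s) - mildValue F G T s x| ≤
        (M + L * Real.exp (L * T) * T * M) * (s - t) := by
    intro u y hy
    have h1 := hS.abs_integral_cost_le hs.1 u y
    have h2 := hS.abs_mildValue_sub_le hs0 (y s) x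
    have h3 : L * Real.exp (L * T) * T * ‖y s - x‖ ≤ L * Real.exp (L * T) * T * (M * (s - t)) := by
      have : 0 ≤ T := hs0.1.trans hs0.2
      gcongr
      exact hy.norm_sub_le hS hs
    linarith
  rw [abs_sub_le_iff]
  refine ⟨?_, sub_le_iff_le_add.2 (le_of_forall_pos_le_add fun η hη => ?_)⟩
  · obtain ⟨a⟩ := ‹Nonempty A›
    obtain ⟨y, hy⟩ := hS.exists_isMildTrajectory (hs.1.trans hs.2) (measurable_const (a := a)) x
    have h1 := hS.mildValue_le_integral_add measurable_const hy hs
    have h2 := key _ y hy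
    have h3 := le_abs_self (∫ r in t..s, G r (y r) a)
    have h4 := le_abs_self (mildValue F G T s (y s) - mildValue F G T s x)
    linarith
  · obtain ⟨u, y, hu, hy, h⟩ := hS.exists_integral_add_le (hs.1.trans hs.2) x hη
    have h1 := h s hs
    have h2 := key _ y hy
    have h3 := neg_abs_le (∫ r in t..s, G r (y r) (u r))
    have h4 := neg_abs_le (mildValue F G T s (y s) - mildValue F G T s x)
    linarith

lemma mildValue_terminal
    (hS : IsControlSystem F G M L) (x : E) : mildValue F G T T x = 0 := by
  simpa using hS.abs_mildValue_le (le_refl T) x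

end IsControlSystem

end Value

/-! ### First-order expansion along trajectories -/

section Viscosity

variable {E A : Type*} [NormedAddCommGroup E] [InnerProductSpace ℝ E] [FiniteDimensional ℝ E]
  [MeasurableSpace E] [BorelSpace E] [MeasurableSpace A]

/-- The Hamiltonian of the undiscounted problem. -/
def mildHamiltonian (F : E → A → E) (G : ℝ → E → A → ℝ) (t : ℝ) (x p : E) : ℝ :=
  ⨅ a, (G t x a + inner ℝ p (F x a))

variable {F : E → A → E} {G : ℝ → E → A → ℝ} {M L t T : ℝ} {x : E} {u : ℝ → A} {y : ℝ → E}

/-- Links the partial derivatives in the definition of viscosity solution to the total derivative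
that governs a trajectory in space-time. -/
lemma hasFDerivAt_eq_deriv_add_inner_gradient {φ : ℝ × E → ℝ} {φ' : ℝ × E →L[ℝ] ℝ} {t : ℝ} {x : E}
    (h : HasFDerivAt φ φ' (t, x)) (s : ℝ) (v : E) :
    φ' (s, v) = deriv (fun s => φ (s, x)) t * s + inner ℝ (gradient (fun y => φ (t, y)) x) v := by
  have h1 : HasDerivAt (fun s => φ (s, x)) (φ' (1, 0)) t := by
    have := h.comp_hasDerivAt t ((hasDerivAt_id t).prodMk (hasDerivAt_const t x))
    exact this
  have h2 : HasFDerivAt (fun y => φ (t, y)) (φ'.comp (ContinuousLinearMap.inr ℝ ℝ E)) x :=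
    h.comp x (hasFDerivAt_prodMk_right t x)
  rw [h1.deriv, gradient, h2.fderiv, InnerProductSpace.toDual_symm_apply]
  have : ((s, v) : ℝ × E) = s • (1, 0) + (0, v) := by simp
  rw [this, map_add, map_smul, smul_eq_mul, mul_comm]
  rfl

lemma intervalIntegrable_const_inner (p : E) {g : ℝ → E} {a b : ℝ}
    (hg : IntervalIntegrable g volume a b) :
    IntervalIntegrable (fun r => inner ℝ p (g r)) volume a b :=
  ⟨(innerSL ℝ p).integrable_comp hg.1, (innerSL ℝ p).integrable_comp hg.2⟩

namespace IsControlSystem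

lemma bddBelow_hamiltonian (hS : IsControlSystem F G M L) (t : ℝ) (x p : E) :
    BddBelow (range fun a => G t x a + inner ℝ p (F x a)) := by
  refine ⟨-(M + ‖p‖ * M), ?_⟩
  rintro _ ⟨a, rfl⟩
  have h1 := (abs_le.1 (hS.cost_bounded t x a)).1
  have h2 := (abs_le.1 (abs_real_inner_le_norm p (F x a))).1
  have h3 := mul_le_mul_of_nonneg_left (hS.dyn_bounded x a) (norm_nonneg p)
  simp only
  linarith

/-- Trajectories issued from `(t,x)` stay in any neighbourhood of `(t,x)` for a short time that
does not depend on the control. -/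
lemma exists_forall_trajectory_of_eventually (hS : IsControlSystem F G M L)
    {P : ℝ × E → Prop} (hP : ∀ᶠ q in nhds (t, x), P q) :
    ∃ δ₀ > 0, ∀ s ∈ Icc t T, s < t + δ₀ → ∀ u y, IsMildTrajectory F t T x u y → P (s, y s) := by
  obtain ⟨ρ, hρ, hP⟩ := Metric.eventually_nhds_iff.1 hP
  have hM := hS.bound_nonneg
  refine ⟨ρ / (1 + M), by positivity, fun s hs hsδ u y hy => hP ?_⟩
  have h1 := hy.norm_sub_le hS hs
  have h2 : (s - t) * (1 + M) < ρ := (lt_div_iff₀ (by positivity)).1 (by linarith)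
  have h3 := hs.1
  rw [Prod.dist_eq, max_lt_iff, dist_eq_norm, dist_eq_norm, Real.norm_of_nonneg (by simpa using h3)]
  constructor
  · simp only
    nlinarith
  · simp only
    nlinarith

/-- First-order expansion of `φ` plus running cost along trajectories, uniform in the control. -/
lemma exists_forall_abs_expansion_le (hS : IsControlSystem F G M L) {φ : ℝ × E → ℝ}
    (hφ : DifferentiableAt ℝ φ (t, x)) {η : ℝ} (hη : 0 < η) :
    ∃ δ₀ > 0, ∀ s ∈ Icc t T, s < t + δ₀ → ∀ u y, Measurable u → IsMildTrajectory F t T x u y →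
      |φ (s, y s) - φ (t, x) + (∫ r in t..s, G r (y r) (u r)) -
        (deriv (fun s => φ (s, x)) t * (s - t) + ∫ r in t..s, (G t x (u r) +
          inner ℝ (gradient (fun y => φ (t, y)) x) (F x (u r))))| ≤ η * (s - t) := by
  have hM := hS.bound_nonneg
  have hL := hS.lipschitz_nonneg
  set p := gradient (fun y => φ (t, y)) x
  set c := deriv (fun s => φ (s, x)) t
  -- The remainder of φ costs κ(1 + M)(s - t) and the time modulus of the cost κ(s - t), together
  -- η/2 per unit time. The Lipschitz error (1 + ‖p‖)LM(s - t)² takes the other half.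
  set κ := η / (2 * (2 + M)) with hκ
  have hκ0 : 0 < κ := by positivity
  obtain ⟨δ₁, hδ₁, hd⟩ := hS.exists_forall_trajectory_of_eventually (T := T)
    ((hasFDerivAt_iff_isLittleO.1 hφ.hasFDerivAt).def hκ0)
  obtain ⟨δ₂, hδ₂, hG⟩ := hS.cost_time {x} isCompact_singleton κ hκ0
  refine ⟨min (min δ₁ δ₂) (η / (2 * ((1 + ‖p‖) * L * M + 1))), by positivity,
    fun s hs hsδ u y hu hy => ?_⟩
  have hst : 0 ≤ s - t := sub_nonneg.2 hs.1
  have hs1 : s < t + δ₁ := hsδ.trans_le (by gcongr; exact (min_le_left _ _).trans (min_le_left _ _))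
  have hs2 : s < t + δ₂ := hsδ.trans_le (by gcongr; exact (min_le_left _ _).trans (min_le_right _ _))
  have hs3 : (1 + ‖p‖) * L * M * (s - t) ≤ η / 2 := by
    have h : s - t < η / (2 * ((1 + ‖p‖) * L * M + 1)) := by
      have := hsδ.trans_le (add_le_add_right (min_le_right _ _) t)
      linarith
    rw [lt_div_iff₀ (by positivity)] at h
    linarith
  have hFi := hS.dyn_intervalIntegrable hu hy.1 t s
  have hFx := hS.dyn_intervalIntegrable hu (continuous_const (y := x)) t s
  have hGi := hS.cost_intervalIntegrable hu hy.1 t s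
  have hGx : IntervalIntegrable (fun r => G t x (u r)) volume t s :=
    intervalIntegrable_of_measurable_of_norm_le
      (hS.cost_measurable.comp (measurable_const.prodMk (measurable_const.prodMk hu)))
      (fun _ => hS.cost_bounded _ _ _) t s
  have hpF : IntervalIntegrable (fun r => inner ℝ p (F (y r) (u r))) volume t s :=
    intervalIntegrable_const_inner p hFi
  have hpx : IntervalIntegrable (fun r => inner ℝ p (F x (u r))) volume t s :=
    intervalIntegrable_const_inner p hFx
  have hlin : fderiv ℝ φ (t, x) ((s, y s) - (t, x)) =
      c * (s - t) + ∫ r in t..s, inner ℝ p (F (y r) (u r)) := by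
    have : ∫ r in t..s, inner ℝ p (F (y r) (u r)) = inner ℝ p (∫ r in t..s, F (y r) (u r)) :=
      (innerSL ℝ p).intervalIntegral_comp_comm hFi
    rw [this, Prod.mk_sub_mk, hasFDerivAt_eq_deriv_add_inner_gradient hφ.hasFDerivAt, hy.2 s hs,
      add_sub_cancel_left]
  have h1 := hd s hs hs1 u y hy
  rw [hlin] at h1
  have h2 : ‖((s, y s) : ℝ × E) - (t, x)‖ ≤ (1 + M) * (s - t) := by
    have := hy.norm_sub_le hS hs
    rw [Prod.mk_sub_mk, Prod.norm_def, max_le_iff, Real.norm_of_nonneg hst]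
    constructor <;> nlinarith
  have h3 : ‖∫ r in t..s, ((G r (y r) (u r) + inner ℝ p (F (y r) (u r))) -
      (G t x (u r) + inner ℝ p (F x (u r))))‖ ≤
        (κ + (1 + ‖p‖) * L * M * (s - t)) * |s - t| := by
    refine intervalIntegral.norm_integral_le_of_norm_le_const fun r hr => ?_
    rw [uIoc_of_le hs.1] at hr
    have hr' : r ∈ Icc t T := ⟨hr.1.le, hr.2.trans hs.2⟩
    have e1 : L * ‖y r - x‖ ≤ L * (M * (s - t)) := by
      gcongr
      exact (hy.norm_sub_le hS hr').trans (by gcongr; exact hr.2)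
    have e2 := hS.cost_lipschitz r (y r) x (u r)
    have e3 := hG r t (by rw [abs_of_nonneg (sub_nonneg.2 hr.1.le)]; linarith [hr.2]) x rfl (u r)
    have e4 : |inner ℝ p (F (y r) (u r) - F x (u r))| ≤ ‖p‖ * (L * ‖y r - x‖) :=
      (abs_real_inner_le_norm _ _).trans (by gcongr; exact hS.dyn_lipschitz _ _ _)
    have e5 := mul_le_mul_of_nonneg_left e1 (norm_nonneg p)
    rw [inner_sub_right] at e4
    rw [Real.norm_eq_abs]
    rw [abs_le] at *
    constructor <;> linarith
  rw [intervalIntegral.integral_sub (hGi.add hpF) (hGx.add hpx),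
    intervalIntegral.integral_add hGi hpF, abs_of_nonneg hst] at h3
  have h4 : κ * ‖((s, y s) : ℝ × E) - (t, x)‖ ≤ κ * ((1 + M) * (s - t)) := by gcongr
  have h5 : κ * (2 + M) = η / 2 := by rw [hκ]; field_simp
  have h6 := mul_le_mul_of_nonneg_right hs3 hst
  have h7 : κ * (2 + M) * (s - t) = η / 2 * (s - t) := by rw [h5]
  rw [Real.norm_eq_abs] at h1 h3
  rw [abs_le] at *
  constructor <;> linarith

end IsControlSystem

end Viscosity

/-! ### The undiscounted value is a viscosity solution -/

section Euclidean

variable {n : ℕ} {A : Type*} [MeasurableSpace A] [Nonempty A]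
  {F : EuclideanSpace ℝ (Fin n) → A → EuclideanSpace ℝ (Fin n)}
  {G : ℝ → EuclideanSpace ℝ (Fin n) → A → ℝ} {M L T : ℝ}

theorem IsControlSystem.isBUC_mildValue (hS : IsControlSystem F G M L) (hT : 0 ≤ T) :
    IsBUC T (mildValue F G T) := by
  have hM := hS.bound_nonneg
  have hL := hS.lipschitz_nonneg
  refine ⟨⟨M * T, fun t ht x => (hS.abs_mildValue_le ht.2 x).trans ?_⟩, ?_⟩
  · exact mul_le_mul_of_nonneg_left (by linarith [ht.1]) hM
  set C := L * Real.exp (L * T) * T with hC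
  have hC0 : 0 ≤ C := by positivity
  have htime : ∀ t ∈ Icc 0 T, ∀ s ∈ Icc 0 T, ∀ x,
      |mildValue F G T t x - mildValue F G T s x| ≤ (M + C * M) * |t - s| := by
    intro t ht s hs x
    rcases le_total t s with h | h
    · rw [abs_sub_comm t s, abs_of_nonneg (sub_nonneg.2 h)]
      exact hS.abs_mildValue_sub_le_time ht.1 ⟨h, hs.2⟩ x
    · rw [abs_sub_comm, abs_of_nonneg (sub_nonneg.2 h)]
      exact hS.abs_mildValue_sub_le_time hs.1 ⟨h, ht.2⟩ x
  refine LipschitzOnWith.uniformContinuousOn (K := Real.toNNReal (M + C * M + C))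
    (LipschitzOnWith.of_dist_le_mul ?_)
  rintro ⟨t, x⟩ ⟨ht, -⟩ ⟨s, z⟩ ⟨hs, -⟩
  rw [Real.coe_toNNReal _ (by positivity), Real.dist_eq, Prod.dist_eq, Real.dist_eq, dist_eq_norm]
  have h1 := htime t ht s hs x
  have h2 := hS.abs_mildValue_sub_le hs x z
  have h3 : (M + C * M) * |t - s| ≤ (M + C * M) * max |t - s| ‖x - z‖ := by
    gcongr; exact le_max_left _ _
  have h4 : C * ‖x - z‖ ≤ C * max |t - s| ‖x - z‖ := by
    gcongr; exact le_max_right _ _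
  have h5 := abs_sub_le (mildValue F G T t x) (mildValue F G T s x) (mildValue F G T s z)
  simp only at *
  linarith

theorem IsControlSystem.isViscositySolutionTerminal_mildValue (hS : IsControlSystem F G M L) :
    IsViscositySolutionTerminal T 0 0 (mildHamiltonian F G) (Ico 0 T) (mildValue F G T) where
  terminal x := hS.mildValue_terminal x
  subsolution φ hφ t ht x hmax := by
    simp only [zero_mul, sub_zero, add_zero]
    have hle : -deriv (fun s => φ (s, x)) t ≤
        mildHamiltonian F G t x (gradient (fun y => φ (t, y)) x) := by
      -- Each control value a is tested separately, through the constant control a.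
      refine le_ciInf fun a => le_of_forall_pos_le_add fun η hη => ?_
      obtain ⟨δ₁, hδ₁, h₁⟩ := hS.exists_forall_trajectory_of_eventually (T := T)
        (eventually_nhdsWithin_iff.1 hmax)
      obtain ⟨δ₂, hδ₂, h₂⟩ := hS.exists_forall_abs_expansion_le (T := T)
        (hφ.differentiable one_ne_zero (t, x)) hη
      obtain ⟨y, hy⟩ := hS.exists_isMildTrajectory ht.2.le (measurable_const (a := a)) x
      obtain ⟨s, hts, hs⟩ := exists_between
        (lt_min (lt_min ht.2 (lt_add_of_pos_right t hδ₁)) (lt_add_of_pos_right t hδ₂))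
      rw [lt_min_iff, lt_min_iff] at hs
      have hsI : s ∈ Icc t T := ⟨hts.le, hs.1.1.le⟩
      have e1 := h₁ s hsI hs.1.2 _ y hy ⟨⟨ht.1.trans hts.le, hs.1.1.le⟩, mem_univ _⟩
      have e2 := (abs_le.1 (h₂ s hsI hs.2 _ y measurable_const hy)).2
      have e3 := hS.mildValue_le_integral_add measurable_const hy hsI
      rw [intervalIntegral.integral_const, smul_eq_mul] at e2
      simp only at e1
      have : 0 ≤ (s - t) * (deriv (fun s => φ (s, x)) t + (G t x a +
          inner ℝ (gradient (fun y => φ (t, y)) x) (F x a)) + η) := by linarith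
      have := nonneg_of_mul_nonneg_right this (sub_pos.2 hts)
      linarith
    linarith
  supersolution φ hφ t ht x hmin := by
    simp only [zero_mul, sub_zero, add_zero]
    set p := gradient (fun y => φ (t, y)) x
    refine le_of_forall_pos_le_add fun η' hη' => ?_
    obtain ⟨η, hη, rfl⟩ : ∃ η > 0, η' = 2 * η := ⟨η' / 2, by positivity, by ring⟩
    obtain ⟨δ₁, hδ₁, h₁⟩ := hS.exists_forall_trajectory_of_eventually (T := T)
      (eventually_nhdsWithin_iff.1 hmin)
    obtain ⟨δ₂, hδ₂, h₂⟩ := hS.exists_forall_abs_expansion_le (T := T)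
      (hφ.differentiable one_ne_zero (t, x)) hη
    obtain ⟨s, hts, hs⟩ := exists_between
      (lt_min (lt_min ht.2 (lt_add_of_pos_right t hδ₁)) (lt_add_of_pos_right t hδ₂))
    rw [lt_min_iff, lt_min_iff] at hs
    have hst := sub_pos.2 hts
    -- The accuracy η(s - t) survives division by s - t. The control depends on s, hence the need
    -- for δ₁ and δ₂ uniform in the control.
    obtain ⟨u, y, hu, hy, h₃⟩ := hS.exists_integral_add_le ht.2.le x (mul_pos hη hst)
    have hsI : s ∈ Icc t T := ⟨hts.le, hs.1.1.le⟩
    have e1 := h₁ s hsI hs.1.2 _ y hy ⟨⟨ht.1.trans hts.le, hs.1.1.le⟩, mem_univ _⟩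
    have e2 := (abs_le.1 (h₂ s hsI hs.2 _ y hu hy)).1
    have e3 := h₃ s hsI
    have e4 : ∫ r in t..s, mildHamiltonian F G t x p ≤
        ∫ r in t..s, (G t x (u r) + inner ℝ p (F x (u r))) := by
      refine intervalIntegral.integral_mono_on hts.le intervalIntegrable_const ?_
        fun r _ => ciInf_le (hS.bddBelow_hamiltonian t x p) (u r)
      refine IntervalIntegrable.add ?_ (intervalIntegrable_const_inner p
        (hS.dyn_intervalIntegrable hu (continuous_const (y := x)) t s))
      exact intervalIntegrable_of_measurable_of_norm_le
        (hS.cost_measurable.comp (measurable_const.prodMk (measurable_const.prodMk hu)))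
        (fun _ => hS.cost_bounded _ _ _) t s
    rw [intervalIntegral.integral_const, smul_eq_mul] at e4
    simp only at e1
    have : (s - t) * (deriv (fun s => φ (s, x)) t + mildHamiltonian F G t x p)
        ≤ (s - t) * (2 * η) := by
      linarith
    have := le_of_mul_le_mul_left this hst
    linarith

end Euclidean

/-! ### Comparison principle by doubling of variables -/

section Comparison

variable {n : ℕ}

/-- A quadratic-exponential test function. -/
def doublingTest (a b c N k r : ℝ) (z : EuclideanSpace ℝ (Fin n))
    (q : ℝ × EuclideanSpace ℝ (Fin n)) : ℝ :=
  a * ‖q.2 - z‖ ^ 2 + b * ‖q.2‖ ^ 2 + c * (q.1 - r) ^ 2 + N * Real.exp (-(k * q.1))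

lemma contDiff_doublingTest (a b c N k r : ℝ) (z : EuclideanSpace ℝ (Fin n)) :
    ContDiff ℝ 1 (doublingTest a b c N k r z) := by
  have h1 : ContDiff ℝ 1 fun q : ℝ × EuclideanSpace ℝ (Fin n) => ‖q.2 - z‖ ^ 2 :=
    (contDiff_snd.sub contDiff_const).norm_sq ℝ
  have h2 : ContDiff ℝ 1 fun q : ℝ × EuclideanSpace ℝ (Fin n) => ‖q.2‖ ^ 2 :=
    contDiff_snd.norm_sq ℝ
  unfold doublingTest
  fun_prop

lemma deriv_doublingTest (a b c N k r t : ℝ) (z x : EuclideanSpace ℝ (Fin n)) :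
    deriv (fun s => doublingTest a b c N k r z (s, x)) t =
      2 * c * (t - r) - k * N * Real.exp (-(k * t)) := by
  have h1 : HasDerivAt (fun s => c * (s - r) ^ 2) (c * (2 * (t - r))) t := by
    simpa using (((hasDerivAt_id t).sub_const r).pow 2).const_mul c
  have h2 : HasDerivAt (fun s => N * Real.exp (-(k * s))) (N * (Real.exp (-(k * t)) * -k)) t := by
    simpa using (((hasDerivAt_id t).const_mul k).neg.exp).const_mul N
  have h3 := (h1.const_add (a * ‖x - z‖ ^ 2 + b * ‖x‖ ^ 2)).add h2
  exact (HasDerivAt.deriv h3).trans (by ring)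

lemma gradient_doublingTest (a b c N k r t : ℝ) (z x : EuclideanSpace ℝ (Fin n)) :
    gradient (fun y => doublingTest a b c N k r z (t, y)) x =
      (2 * a) • (x - z) + (2 * b) • x := by
  refine HasGradientAt.gradient (hasGradientAt_iff_hasFDerivAt.2 ?_)
  have h1 := (((hasFDerivAt_id x).sub_const z).norm_sq).const_mul a
  have h2 := ((hasFDerivAt_id x).norm_sq).const_mul b
  refine (((h1.add h2).add_const (c * (t - r) ^ 2)).add_const
    (N * Real.exp (-(k * t)))).congr_fderiv ?_
  ext v
  simp
  ring

/-- Comparison by doubling of variables: bounded uniformly continuous solutions that vanish at the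
terminal time are ordered, hence equal. The equation need only hold at interior times. -/
theorem le_of_isViscositySolutionTerminal {T L M : ℝ} (hL : 0 ≤ L)
    {H : ℝ → EuclideanSpace ℝ (Fin n) → EuclideanSpace ℝ (Fin n) → ℝ}
    (hHx : ∀ t x y p, |H t x p - H t y p| ≤ L * (1 + ‖p‖) * ‖x - y‖)
    (hHp : ∀ t x p q, |H t x p - H t x q| ≤ M * ‖p - q‖)
    (hHt : ∀ K : Set (EuclideanSpace ℝ (Fin n)), IsCompact K → ∀ η > 0, ∃ δ > 0, ∀ s t,
      |s - t| < δ → ∀ x ∈ K, ∀ p, |H s x p - H t x p| ≤ η)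
    {u v : ℝ → EuclideanSpace ℝ (Fin n) → ℝ} (hu : IsBUC T u) (hv : IsBUC T v)
    (hus : IsViscositySolutionTerminal T 0 0 H (Ioo 0 T) u)
    (hvs : IsViscositySolutionTerminal T 0 0 H (Ioo 0 T) v)
    {t : ℝ} (ht : t ∈ Ioo 0 T) (x : EuclideanSpace ℝ (Fin n)) : u t x ≤ v t x := by
  by_contra! hlt
  obtain ⟨⟨Cu, hCu⟩, huc⟩ := hu
  obtain ⟨⟨Cv, hCv⟩, hvc⟩ := hv
  have hT : 0 < T := ht.1.trans ht.2
  have htI : t ∈ Icc 0 T := Ioo_subset_Icc_self ht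
  -- Of the gap 6σ, the localisation at x takes at most σ and the two barriers at t at most 2σ; 3σ
  -- remain, more than the σ to be contradicted at terminal time.
  obtain ⟨σ, hσ, hσe⟩ : ∃ σ > 0, u t x - v t x = 6 * σ :=
    ⟨(u t x - v t x) / 6, by linarith, by ring⟩
  obtain ⟨D, hD, huv⟩ : ∃ D > 0, ∀ s ∈ Icc 0 T, ∀ r ∈ Icc 0 T, ∀ x y, u s x - v r y ≤ D := by
    refine ⟨|Cu| + |Cv| + 1, by positivity, fun s hs r hr x y => ?_⟩
    have h1 := (abs_le.1 (hCu s hs x)).2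
    have h2 := (abs_le.1 (hCv r hr y)).1
    have h3 := le_abs_self Cu
    have h4 := le_abs_self Cv
    linarith
  -- the exponential barrier keeping maxima away from time `0`
  obtain ⟨N, hN⟩ : ∃ N, N = D + 1 := ⟨_, rfl⟩
  have hN0 : 0 < N := by linarith
  obtain ⟨k, hk, hkt⟩ : ∃ k > 0, N * Real.exp (-(k * t)) ≤ σ := by
    refine ⟨N / σ / t, div_pos (by positivity) ht.1, ?_⟩
    rw [div_mul_cancel₀ _ ht.1.ne', Real.exp_neg, mul_inv_le_iff₀ (Real.exp_pos _)]
    have h1 := Real.add_one_le_exp (N / σ)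
    have h2 : N = σ * (N / σ) := by field_simp
    have h3 := mul_le_mul_of_nonneg_left h1 hσ.le
    linarith
  -- A lower bound on [0,T] for the rate of decrease of the barrier: the strictness that all later
  -- errors must not exceed.
  obtain ⟨c, hc⟩ : ∃ c, c = k * N * Real.exp (-(k * T)) := ⟨_, rfl⟩
  have hc0 : 0 < c := by rw [hc]; positivity
  have hcle : ∀ s ≤ T, c ≤ k * N * Real.exp (-(k * s)) := by
    intro s hs
    rw [hc]
    gcongr
  -- the spatial doubling parameter `a`
  obtain ⟨γ, hγ, hγL⟩ : ∃ γ > 0, 2 * L * γ ≤ c / 4 := by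
    refine ⟨c / (8 * (L + 1)), by positivity, ?_⟩
    rw [mul_div_assoc', div_le_iff₀ (by positivity)]
    nlinarith
  obtain ⟨δ₀, hδ₀, hvx⟩ := Metric.uniformContinuousOn_iff.1 hvc γ hγ
  obtain ⟨δ, hδ, hδle, hδL⟩ : ∃ δ > 0, δ ≤ δ₀ ∧ L * δ ≤ c / 4 := by
    refine ⟨min δ₀ (c / (4 * (L + 1))), by positivity, min_le_left _ _, ?_⟩
    refine (mul_le_mul_of_nonneg_left (min_le_right _ _) hL).trans ?_
    rw [mul_div_assoc', div_le_iff₀ (by positivity)]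
    nlinarith
  -- Wherever the doubled function is positive each penalty is below D, so a‖x - y‖² < D = aδ²
  -- forces ‖x - y‖ < δ. The parameter d is obtained from δt in the same way.
  obtain ⟨a, ha, haδ⟩ : ∃ a > 0, a * δ ^ 2 = D := ⟨D / δ ^ 2, by positivity, by field_simp⟩
  -- the localisation parameter `b`
  obtain ⟨b, hb, hbx, hbM⟩ : ∃ b > 0, b * ‖x‖ ^ 2 ≤ σ ∧ 4 * M ^ 2 * b * D ≤ (c / 4) ^ 2 := by
    refine ⟨min (σ / (‖x‖ ^ 2 + 1)) ((c / 4) ^ 2 / (4 * M ^ 2 * D + 1)), by positivity, ?_, ?_⟩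
    · refine (mul_le_mul_of_nonneg_right (min_le_left _ _) (by positivity)).trans ?_
      rw [div_mul_eq_mul_div, div_le_iff₀ (by positivity)]
      nlinarith
    · have : 4 * M ^ 2 * D * min (σ / (‖x‖ ^ 2 + 1)) ((c / 4) ^ 2 / (4 * M ^ 2 * D + 1)) ≤
          4 * M ^ 2 * D * ((c / 4) ^ 2 / (4 * M ^ 2 * D + 1)) := by
        gcongr
        exact min_le_right _ _
      have h2 : 4 * M ^ 2 * D * ((c / 4) ^ 2 / (4 * M ^ 2 * D + 1)) ≤ (c / 4) ^ 2 := by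
        rw [mul_div_assoc', div_le_iff₀ (by positivity)]
        nlinarith [sq_nonneg (c / 4)]
      linarith
  obtain ⟨R, hR0, hR⟩ : ∃ R > 0, ∀ z : EuclideanSpace ℝ (Fin n), b * ‖z‖ ^ 2 ≤ D → ‖z‖ ≤ R := by
    refine ⟨D / b + 1, by positivity, fun z hz => ?_⟩
    have : ‖z‖ ^ 2 ≤ D / b := (le_div_iff₀ hb).2 (by linarith)
    nlinarith [sq_nonneg (‖z‖ - 1)]
  -- the temporal doubling parameter `d`
  obtain ⟨δ₁, hδ₁, hHtime⟩ := hHt (Metric.closedBall 0 (R + δ)) (isCompact_closedBall _ _)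
    (c / 2) (by positivity)
  obtain ⟨δ₂, hδ₂, huT⟩ := Metric.uniformContinuousOn_iff.1 huc σ hσ
  obtain ⟨δ₃, hδ₃, hvT⟩ := Metric.uniformContinuousOn_iff.1 hvc σ hσ
  obtain ⟨δt, hδt, hδt1, hδt2, hδt3⟩ : ∃ δt > 0, δt ≤ δ₁ ∧ δt ≤ δ₂ ∧ δt ≤ δ₃ :=
    ⟨min δ₁ (min δ₂ δ₃), by positivity, min_le_left _ _,
      (min_le_right _ _).trans (min_le_left _ _), (min_le_right _ _).trans (min_le_right _ _)⟩
  obtain ⟨d, hd, hdδ⟩ : ∃ d > 0, d * δt ^ 2 = D := ⟨D / δt ^ 2, by positivity, by field_simp⟩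
  -- the doubled function and its maximum
  let Φ : (ℝ × EuclideanSpace ℝ (Fin n)) × ℝ × EuclideanSpace ℝ (Fin n) → ℝ := fun q =>
    u q.1.1 q.1.2 - v q.2.1 q.2.2 - (a * ‖q.1.2 - q.2.2‖ ^ 2 + b * ‖q.1.2‖ ^ 2 +
      d * (q.1.1 - q.2.1) ^ 2 + N * Real.exp (-(k * q.1.1)) + N * Real.exp (-(k * q.2.1)))
  have hΦ1 : 3 * σ ≤ Φ ((t, x), (t, x)) := by
    simp only [Φ, sub_self, norm_zero]
    linarith
  have hpos : ∀ t₀ ∈ Icc 0 T, ∀ s₀ ∈ Icc 0 T, ∀ x₀ y₀, 0 < Φ ((t₀, x₀), (s₀, y₀)) →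
      a * ‖x₀ - y₀‖ ^ 2 < D ∧ b * ‖x₀‖ ^ 2 < D ∧ d * (t₀ - s₀) ^ 2 < D ∧
        N * Real.exp (-(k * t₀)) < D ∧ N * Real.exp (-(k * s₀)) < D := by
    intro t₀ ht₀ s₀ hs₀ x₀ y₀ h
    simp only [Φ] at h
    have h0 := huv t₀ ht₀ s₀ hs₀ x₀ y₀
    have h1 : 0 ≤ a * ‖x₀ - y₀‖ ^ 2 := by positivity
    have h2 : 0 ≤ b * ‖x₀‖ ^ 2 := by positivity
    have h3 : 0 ≤ d * (t₀ - s₀) ^ 2 := by positivity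
    have h4 : 0 < N * Real.exp (-(k * t₀)) := by positivity
    have h5 : 0 < N * Real.exp (-(k * s₀)) := by positivity
    refine ⟨?_, ?_, ?_, ?_, ?_⟩ <;> linarith
  have hnear : ∀ x₀ y₀ : EuclideanSpace ℝ (Fin n), a * ‖x₀ - y₀‖ ^ 2 < D → ‖x₀ - y₀‖ < δ := by
    intro x₀ y₀ h
    rw [← haδ] at h
    exact lt_of_pow_lt_pow_left₀ 2 hδ.le (lt_of_mul_lt_mul_left h ha.le)
  let K : Set ((ℝ × EuclideanSpace ℝ (Fin n)) × ℝ × EuclideanSpace ℝ (Fin n)) :=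
    (Icc 0 T ×ˢ Metric.closedBall 0 R) ×ˢ (Icc 0 T ×ˢ Metric.closedBall 0 (R + δ))
  have hK : ∀ t₀ ∈ Icc 0 T, ∀ s₀ ∈ Icc 0 T, ∀ x₀ y₀, 0 < Φ ((t₀, x₀), (s₀, y₀)) →
      ((t₀, x₀), (s₀, y₀)) ∈ K := by
    intro t₀ ht₀ s₀ hs₀ x₀ y₀ h
    obtain ⟨h1, h2, -⟩ := hpos t₀ ht₀ s₀ hs₀ x₀ y₀ h
    have h3 := hR x₀ h2.le
    have h4 := hnear x₀ y₀ h1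
    have h5 : ‖y₀‖ ≤ ‖x₀‖ + ‖x₀ - y₀‖ := norm_le_norm_add_norm_sub x₀ y₀
    refine ⟨⟨ht₀, by simpa using h3⟩, hs₀, ?_⟩
    rw [mem_closedBall_zero_iff]
    linarith
  have hΦc : ContinuousOn Φ K := by
    have h1 : ContinuousOn (fun q : (ℝ × EuclideanSpace ℝ (Fin n)) × ℝ × EuclideanSpace ℝ (Fin n) =>
        u q.1.1 q.1.2) K :=
      huc.continuousOn.comp continuous_fst.continuousOn fun q hq => ⟨hq.1.1, mem_univ _⟩
    have h2 : ContinuousOn (fun q : (ℝ × EuclideanSpace ℝ (Fin n)) × ℝ × EuclideanSpace ℝ (Fin n) =>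
        v q.2.1 q.2.2) K :=
      hvc.continuousOn.comp continuous_snd.continuousOn fun q hq => ⟨hq.2.1, mem_univ _⟩
    refine (h1.sub h2).sub (Continuous.continuousOn ?_)
    fun_prop
  have hKc : IsCompact K := (isCompact_Icc.prod (isCompact_closedBall _ _)).prod
    (isCompact_Icc.prod (isCompact_closedBall _ _))
  obtain ⟨⟨⟨t₀, x₀⟩, s₀, y₀⟩, hq, hmax⟩ := hKc.exists_isMaxOn
    ⟨_, hK t htI t htI x x (by linarith)⟩ hΦc
  have hΦ0 : 3 * σ ≤ Φ ((t₀, x₀), (s₀, y₀)) :=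
    hΦ1.trans (hmax (hK t htI t htI x x (by linarith)))
  have ht₀ : t₀ ∈ Icc 0 T := hq.1.1
  have hs₀ : s₀ ∈ Icc 0 T := hq.2.1
  -- Off K the function Φ is at most 0, so the maximum over the compact K is a maximum for all
  -- states and all times in [0,T].
  have hglobal : ∀ t' ∈ Icc 0 T, ∀ s' ∈ Icc 0 T, ∀ x' y',
      Φ ((t', x'), (s', y')) ≤ Φ ((t₀, x₀), (s₀, y₀)) := by
    intro t' ht' s' hs' x' y'
    by_cases h : 0 < Φ ((t', x'), (s', y'))
    · exact hmax (hK t' ht' s' hs' x' y' h)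
    · linarith
  obtain ⟨hax, hbx₀, hdt, hNt, hNs⟩ := hpos t₀ ht₀ s₀ hs₀ x₀ y₀ (by linarith)
  have hxy := hnear x₀ y₀ hax
  have hts : |t₀ - s₀| < δt := by
    rw [← hdδ] at hdt
    exact abs_lt_of_sq_lt_sq (lt_of_mul_lt_mul_left hdt hd.le) hδt.le
  have hΦle : Φ ((t₀, x₀), (s₀, y₀)) ≤ u t₀ x₀ - v s₀ y₀ := by
    have : 0 ≤ a * ‖x₀ - y₀‖ ^ 2 + b * ‖x₀‖ ^ 2 + d * (t₀ - s₀) ^ 2 +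
      N * Real.exp (-(k * t₀)) + N * Real.exp (-(k * s₀)) := by positivity
    simp only [Φ]
    linarith
  have hTI : T ∈ Icc 0 T := ⟨hT.le, le_rfl⟩
  -- the maximum is at interior times
  have ht₀' : t₀ ∈ Ioo 0 T := by
    refine ⟨lt_of_le_of_ne ht₀.1 ?_, lt_of_le_of_ne ht₀.2 ?_⟩
    · rintro rfl
      simp only [mul_zero, neg_zero, Real.exp_zero] at hNt
      linarith
    · rintro rfl
      have := hvT (t₀, y₀) ⟨hTI, mem_univ _⟩ (s₀, y₀) ⟨hs₀, mem_univ _⟩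
        (by rw [Prod.dist_eq]; simpa [Real.dist_eq, hδ₃] using hts.trans_le hδt3)
      rw [Real.dist_eq, hvs.terminal] at this
      have h1 := (abs_lt.1 this).2
      rw [hus.terminal] at hΦle
      linarith
  have hs₀' : s₀ ∈ Ioo 0 T := by
    refine ⟨lt_of_le_of_ne hs₀.1 ?_, lt_of_le_of_ne hs₀.2 ?_⟩
    · rintro rfl
      simp only [mul_zero, neg_zero, Real.exp_zero] at hNs
      linarith
    · rintro rfl
      have := huT (t₀, x₀) ⟨ht₀, mem_univ _⟩ (s₀, x₀) ⟨hTI, mem_univ _⟩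
        (by rw [Prod.dist_eq]; simpa [Real.dist_eq, hδ₂] using hts.trans_le hδt2)
      rw [Real.dist_eq, hus.terminal] at this
      have h1 := (abs_lt.1 this).2
      rw [hvs.terminal] at hΦle
      linarith
  -- the two viscosity inequalities
  have hsub := hus.subsolution (doublingTest a b d N k s₀ y₀) (contDiff_doublingTest ..) t₀ ht₀' x₀
    (IsMaxOn.localize fun q hq => by
      have := hglobal q.1 hq.1 s₀ hs₀ q.2 y₀
      simp only [Φ] at this
      simp only [doublingTest, mem_ofPred_eq]
      linarith)
  -- Seen from the second pair of variables the penalties change sign, and the localisation term,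
  -- which involves only the first state, drops out.
  have hsup := hvs.supersolution (doublingTest (-a) 0 (-d) (-N) k t₀ x₀)
    (contDiff_doublingTest ..) s₀ hs₀' y₀ (IsMinOn.localize fun q hq => by
      have := hglobal t₀ ht₀ q.1 hq.1 x₀ q.2
      simp only [Φ] at this
      rw [norm_sub_rev x₀ q.2, norm_sub_rev x₀ y₀, ← neg_sub q.1 t₀, ← neg_sub s₀ t₀, neg_sq,
        neg_sq] at this
      simp only [doublingTest, mem_ofPred_eq]
      linarith)
  rw [deriv_doublingTest, gradient_doublingTest] at hsub hsup
  have hgrad : (2 * -a) • (y₀ - x₀) + (2 * (0 : ℝ)) • y₀ = (2 * a) • (x₀ - y₀) := by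
    rw [mul_zero, zero_smul, add_zero, mul_neg, neg_smul, ← smul_neg, neg_sub]
  rw [hgrad] at hsup
  obtain ⟨p, hp⟩ : ∃ p, p = (2 * a) • (x₀ - y₀) := ⟨_, rfl⟩
  rw [← hp] at hsub hsup
  have hpn : ‖p‖ = 2 * a * ‖x₀ - y₀‖ := by
    rw [hp, norm_smul, Real.norm_of_nonneg (by positivity)]
  -- comparing with the point `(t₀, x₀, s₀, x₀)` on the diagonal
  have hdiag : a * ‖x₀ - y₀‖ ^ 2 ≤ γ := by
    have h1 := hglobal t₀ ht₀ s₀ hs₀ x₀ x₀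
    simp only [Φ, sub_self, norm_zero] at h1
    have h2 := hvx (s₀, x₀) ⟨hs₀, mem_univ _⟩ (s₀, y₀) ⟨hs₀, mem_univ _⟩
      (by rw [Prod.dist_eq]; simpa [dist_eq_norm, hδ₀] using hxy.trans_le hδle)
    rw [Real.dist_eq] at h2
    have h3 := (abs_lt.1 h2).2
    simp only at h3
    linarith
  -- Subtracting the viscosity inequalities cancels the d-terms. The barriers contribute at least
  -- 2c, while the errors in momentum, state and time are at most c/4, c/2 and c/2.
  have e1 := (abs_le.1 (hHp t₀ x₀ (p + (2 * b) • x₀) p)).2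
  have e2 := (abs_le.1 (hHx t₀ x₀ y₀ p)).2
  have e3 := (abs_le.1 (hHtime t₀ s₀ (hts.trans_le hδt1) y₀ hq.2.2 p)).2
  have e4 : M * ‖p + (2 * b) • x₀ - p‖ ≤ c / 4 := by
    rw [add_sub_cancel_left, norm_smul, Real.norm_of_nonneg (by positivity)]
    refine le_of_sq_le_sq ?_ (by positivity)
    have : 4 * M ^ 2 * b * (b * ‖x₀‖ ^ 2) ≤ 4 * M ^ 2 * b * D := by gcongr
    linarith
  -- The dangerous part is L‖p‖‖x₀ - y₀‖ = 2L · a‖x₀ - y₀‖², which `hdiag` bounds by 2Lγ although a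
  -- may be large.
  have e5 : L * (1 + ‖p‖) * ‖x₀ - y₀‖ ≤ c / 4 + c / 4 := by
    rw [hpn]
    have h1 : L * ‖x₀ - y₀‖ ≤ L * δ := by gcongr
    have h2 : 2 * L * (a * ‖x₀ - y₀‖ ^ 2) ≤ 2 * L * γ := by gcongr
    linarith
  have e6 := hcle t₀ ht₀.2
  have e7 := hcle s₀ hs₀.2
  linarith

end Comparison

/-! ### Regularity of the Hamiltonian -/

section HamiltonianRegularity

variable {E A : Type*} [NormedAddCommGroup E] [InnerProductSpace ℝ E] [FiniteDimensional ℝ E]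
  [MeasurableSpace E] [BorelSpace E] [MeasurableSpace A] [Nonempty A]
  {F : E → A → E} {G : ℝ → E → A → ℝ} {M L : ℝ}

lemma abs_ciInf_sub_ciInf_le {ι : Type*} [Nonempty ι] {f g : ι → ℝ} (hf : BddBelow (range f))
    (hg : BddBelow (range g)) {C : ℝ} (h : ∀ i, |f i - g i| ≤ C) : |(⨅ i, f i) - ⨅ i, g i| ≤ C := by
  refine abs_sub_le_iff.2 ⟨?_, ?_⟩
  · rw [sub_le_iff_le_add', ← sub_le_iff_le_add]
    exact le_ciInf fun i => by linarith [ciInf_le hf i, (abs_le.1 (h i)).2]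
  · rw [sub_le_iff_le_add', ← sub_le_iff_le_add]
    exact le_ciInf fun i => by linarith [ciInf_le hg i, (abs_le.1 (h i)).1]

namespace IsControlSystem

lemma abs_mildHamiltonian_sub_le_state (hS : IsControlSystem F G M L) (t : ℝ) (x y p : E) :
    |mildHamiltonian F G t x p - mildHamiltonian F G t y p| ≤ L * (1 + ‖p‖) * ‖x - y‖ := by
  refine abs_ciInf_sub_ciInf_le (hS.bddBelow_hamiltonian t x p) (hS.bddBelow_hamiltonian t y p)
    fun a => ?_
  have h1 := hS.cost_lipschitz t x y a
  have h2 := (abs_real_inner_le_norm p (F x a - F y a)).trans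
    (mul_le_mul_of_nonneg_left (hS.dyn_lipschitz x y a) (norm_nonneg p))
  rw [inner_sub_right] at h2
  rw [add_sub_add_comm]
  refine (abs_add_le _ _).trans ?_
  linarith

lemma abs_mildHamiltonian_sub_le_momentum (hS : IsControlSystem F G M L) (t : ℝ) (x p q : E) :
    |mildHamiltonian F G t x p - mildHamiltonian F G t x q| ≤ M * ‖p - q‖ := by
  refine abs_ciInf_sub_ciInf_le (hS.bddBelow_hamiltonian t x p) (hS.bddBelow_hamiltonian t x q)
    fun a => ?_
  rw [add_sub_add_left_eq_sub, ← inner_sub_left, mul_comm]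
  exact (abs_real_inner_le_norm _ _).trans
    (mul_le_mul_of_nonneg_left (hS.dyn_bounded x a) (norm_nonneg _))

/-- The dynamics are autonomous, so the momentum terms cancel and δ does not depend on p. -/
lemma exists_abs_mildHamiltonian_sub_le_time (hS : IsControlSystem F G M L) {K : Set E}
    (hK : IsCompact K) {η : ℝ} (hη : 0 < η) : ∃ δ > 0, ∀ s t, |s - t| < δ → ∀ x ∈ K, ∀ p,
      |mildHamiltonian F G s x p - mildHamiltonian F G t x p| ≤ η := by
  obtain ⟨δ, hδ, h⟩ := hS.cost_time K hK η hη
  refine ⟨δ, hδ, fun s t hst x hx p => abs_ciInf_sub_ciInf_le (hS.bddBelow_hamiltonian s x p)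
    (hS.bddBelow_hamiltonian t x p) fun a => ?_⟩
  rw [add_sub_add_right_eq_sub]
  exact h s t hst x hx a

end IsControlSystem

end HamiltonianRegularity

/-! ### Uniqueness for the undiscounted problem -/

section Uniqueness

variable {n : ℕ} {A : Type*} [MeasurableSpace A] [Nonempty A]
  {F : EuclideanSpace ℝ (Fin n) → A → EuclideanSpace ℝ (Fin n)}
  {G : ℝ → EuclideanSpace ℝ (Fin n) → A → ℝ} {M L T : ℝ}

lemma IsViscositySolutionTerminal.mono {lam ε : ℝ}
    {H : ℝ → EuclideanSpace ℝ (Fin n) → EuclideanSpace ℝ (Fin n) → ℝ} {I J : Set ℝ}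
    {V : ℝ → EuclideanSpace ℝ (Fin n) → ℝ} (h : IsViscositySolutionTerminal T lam ε H J V)
    (hIJ : I ⊆ J) : IsViscositySolutionTerminal T lam ε H I V :=
  ⟨h.terminal, fun φ hφ t ht => h.subsolution φ hφ t (hIJ ht),
    fun φ hφ t ht => h.supersolution φ hφ t (hIJ ht)⟩

theorem IsControlSystem.eq_mildValue (hS : IsControlSystem F G M L) (hT : 0 < T)
    {V : ℝ → EuclideanSpace ℝ (Fin n) → ℝ} (hV : IsBUC T V)
    (hVs : IsViscositySolutionTerminal T 0 0 (mildHamiltonian F G) (Ioo 0 T) V) :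
    ∀ t ∈ Icc 0 T, ∀ x, V t x = mildValue F G T t x := by
  intro t ht x
  have hB := hS.isBUC_mildValue hT.le
  have hBs := (hS.isViscositySolutionTerminal_mildValue (T := T)).mono Ioo_subset_Ico_self
  have hEq : EqOn (fun t => V t x) (fun t => mildValue F G T t x) (Ioo 0 T) := by
    intro t ht
    refine le_antisymm ?_ ?_
    · exact le_of_isViscositySolutionTerminal hS.lipschitz_nonneg
        hS.abs_mildHamiltonian_sub_le_state hS.abs_mildHamiltonian_sub_le_momentum
        (fun K hK η hη => hS.exists_abs_mildHamiltonian_sub_le_time hK hη) hV hB hVs hBs ht x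
    · exact le_of_isViscositySolutionTerminal hS.lipschitz_nonneg
        hS.abs_mildHamiltonian_sub_le_state hS.abs_mildHamiltonian_sub_le_momentum
        (fun K hK η hη => hS.exists_abs_mildHamiltonian_sub_le_time hK hη) hB hV hBs hVs ht x
  have hcont : ∀ {W : ℝ → EuclideanSpace ℝ (Fin n) → ℝ}, IsBUC T W →
      ContinuousOn (fun t => W t x) (Icc 0 T) := fun hW =>
    hW.2.continuousOn.comp (f := fun t => (t, x)) (by fun_prop) fun s hs => ⟨hs, mem_univ _⟩
  -- Equality at interior times extends to both endpoints by continuity.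
  exact hEq.of_subset_closure (hcont hV) (hcont hB) Ioo_subset_Icc_self
    (closure_Ioo hT.ne).ge ht

end Uniqueness

/-! ### Change of discount rate and time reversal -/

section Transformations

variable {n : ℕ} {T lam ε : ℝ} {H : ℝ → EuclideanSpace ℝ (Fin n) → EuclideanSpace ℝ (Fin n) → ℝ}
  {I J : Set ℝ} {V W : ℝ → EuclideanSpace ℝ (Fin n) → ℝ}

lemma deriv_exp_mul_test {φ : ℝ × EuclideanSpace ℝ (Fin n) → ℝ} (hφ : ContDiff ℝ 1 φ)
    (μ c ε t : ℝ) (x : EuclideanSpace ℝ (Fin n)) :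
    deriv (fun s => Real.exp (μ * s) * (φ (s, x) + c) + ε) t =
      Real.exp (μ * t) * (μ * (φ (t, x) + c) + deriv (fun s => φ (s, x)) t) := by
  have h1 : HasDerivAt (fun s => Real.exp (μ * s)) (Real.exp (μ * t) * μ) t := by
    simpa using ((hasDerivAt_id t).const_mul μ).exp
  have h2 : DifferentiableAt ℝ (fun s => φ (s, x)) t :=
    ((hφ.comp (contDiff_prodMk_left x)).differentiable one_ne_zero) t
  refine (HasDerivAt.deriv ((h1.mul (h2.hasDerivAt.add_const c)).add_const ε)).trans ?_
  ring

lemma gradient_exp_mul_test {φ : ℝ × EuclideanSpace ℝ (Fin n) → ℝ} (hφ : ContDiff ℝ 1 φ)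
    (e c ε t : ℝ) (x : EuclideanSpace ℝ (Fin n)) :
    gradient (fun y => e * (φ (t, y) + c) + ε) x = e • gradient (fun y => φ (t, y)) x := by
  have h2 : DifferentiableAt ℝ (fun y => φ (t, y)) x :=
    ((hφ.comp (contDiff_prodMk_right t)).differentiable one_ne_zero) x
  refine HasGradientAt.gradient (hasGradientAt_iff_hasFDerivAt.2 ?_)
  rw [map_smul]
  exact (((hasGradientAt_iff_hasFDerivAt.1 h2.hasGradientAt).add_const c).const_mul e).add_const ε

/-- Multiplying a solution by `e^{-μt}` shifts the discount rate by `μ`. -/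
lemma IsViscositySolutionTerminal.exp_mul (hV : IsViscositySolutionTerminal T lam ε H I V)
    (hT : 0 ≤ T) (hI : I ⊆ Icc 0 T) (μ ε' : ℝ)
    {H' : ℝ → EuclideanSpace ℝ (Fin n) → EuclideanSpace ℝ (Fin n) → ℝ}
    (hH : ∀ t ∈ I, ∀ x p, H' t x p = Real.exp (-(μ * t)) * H t x (Real.exp (μ * t) • p))
    (hW : ∀ t ∈ Icc 0 T, ∀ x, W t x = Real.exp (-(μ * t)) * (V t x - ε) + ε') :
    IsViscositySolutionTerminal T (lam - μ) ε' H' I W := by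
  have hVW : ∀ t ∈ Icc 0 T, ∀ x, V t x = Real.exp (μ * t) * (W t x - ε') + ε := by
    intro t ht x
    rw [hW t ht x, add_sub_cancel_right, ← mul_assoc, ← Real.exp_add, add_neg_cancel,
      Real.exp_zero]
    ring
  have hC1 : ∀ φ : ℝ × EuclideanSpace ℝ (Fin n) → ℝ, ContDiff ℝ 1 φ → ∀ c : ℝ,
      ContDiff ℝ 1 fun q : ℝ × EuclideanSpace ℝ (Fin n) =>
        Real.exp (μ * q.1) * (φ q + c) + ε := by
    intro φ hφ c
    fun_prop
  -- With this c, the test function e^{μt}(φ + c) + ε agrees with V at the test point. Elsewhere V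
  -- minus it is e^{μs} times the increment of W - φ, and the positive factor preserves its sign.
  have key : ∀ (φ : ℝ × EuclideanSpace ℝ (Fin n) → ℝ) (t : ℝ) (x : EuclideanSpace ℝ (Fin n)) (c : ℝ),
      ContDiff ℝ 1 φ → t ∈ I → c = W t x - φ (t, x) - ε' →
      deriv (fun s => φ (s, x)) t + H' t x (gradient (fun y => φ (t, y)) x)
        - (lam - μ) * W t x + (lam - μ) * ε' = Real.exp (-(μ * t)) *
      (deriv (fun s => Real.exp (μ * s) * (φ (s, x) + c) + ε) t +
        H t x (gradient (fun y => Real.exp (μ * t) * (φ (t, y) + c) + ε) x)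
        - lam * V t x + lam * ε) := by
    rintro φ t x c hφ ht rfl
    rw [deriv_exp_mul_test hφ, gradient_exp_mul_test hφ, hH t ht, hVW t (hI ht) x]
    have : Real.exp (-(μ * t)) * Real.exp (μ * t) = 1 := by
      rw [← Real.exp_add, neg_add_cancel, Real.exp_zero]
    linear_combination (-(μ * (φ (t, x) + (W t x - φ (t, x) - ε')) +
      deriv (fun s => φ (s, x)) t - lam * (W t x - ε'))) * this
  refine ⟨fun x => ?_, fun φ hφ t ht x hmax => ?_, fun φ hφ t ht x hmin => ?_⟩
  · rw [hW T ⟨hT, le_rfl⟩, hV.terminal]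
    simp
  · rw [key φ t x _ hφ ht rfl]
    refine mul_nonneg (Real.exp_pos _).le (hV.subsolution _ (hC1 φ hφ _) t ht x ?_)
    filter_upwards [hmax, self_mem_nhdsWithin] with q hq hqI
    rw [hVW q.1 hqI.1, hVW t (hI ht)]
    have : Real.exp (μ * q.1) * (W q.1 q.2 - φ q - (W t x - φ (t, x))) ≤ 0 :=
      mul_nonpos_of_nonneg_of_nonpos (Real.exp_pos _).le (by linarith)
    linarith
  · rw [key φ t x _ hφ ht rfl]
    refine mul_nonpos_of_nonneg_of_nonpos (Real.exp_pos _).le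
      (hV.supersolution _ (hC1 φ hφ _) t ht x ?_)
    filter_upwards [hmin, self_mem_nhdsWithin] with q hq hqI
    rw [hVW q.1 hqI.1, hVW t (hI ht)]
    have : 0 ≤ Real.exp (μ * q.1) * (W q.1 q.2 - φ q - (W t x - φ (t, x))) :=
      mul_nonneg (Real.exp_pos _).le (by linarith)
    linarith

lemma IsBUC.exp_mul (hV : IsBUC T V) (μ ε ε' : ℝ)
    (hW : ∀ t ∈ Icc 0 T, ∀ x, W t x = Real.exp (-(μ * t)) * (V t x - ε) + ε') : IsBUC T W := by
  obtain ⟨⟨C, hC⟩, hVc⟩ := hV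
  obtain ⟨B, hB⟩ := isCompact_Icc.exists_bound_of_continuousOn (s := Icc 0 T)
    (f := fun t => Real.exp (-(μ * t))) (by fun_prop)
  have hbd : ∀ t ∈ Icc 0 T, ∀ x, |V t x - ε| ≤ |C| + |ε| := fun t ht x =>
    (norm_sub_le (V t x) ε).trans (add_le_add_left ((hC t ht x).trans (le_abs_self C)) _)
  have hBabs : ∀ t ∈ Icc 0 T, |Real.exp (-(μ * t))| ≤ |B| := fun t ht =>
    (hB t ht).trans (le_abs_self B)
  refine ⟨⟨|B| * (|C| + |ε|) + |ε'|, fun t ht x => ?_⟩, ?_⟩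
  · rw [hW t ht x]
    refine (abs_add_le _ _).trans ?_
    rw [abs_mul]
    have h1 := hBabs t ht
    have h2 := hbd t ht x
    gcongr
  · have hec : UniformContinuousOn (fun t => Real.exp (-(μ * t))) (Icc 0 T) :=
      isCompact_Icc.uniformContinuousOn_of_continuous (by fun_prop)
    rw [Metric.uniformContinuousOn_iff] at *
    intro η hη
    obtain ⟨δ₁, hδ₁, h₁⟩ := hVc (η / (2 * (|B| + 1))) (by positivity)
    obtain ⟨δ₂, hδ₂, h₂⟩ := hec (η / (2 * (|C| + |ε| + 1))) (by positivity)
    refine ⟨min δ₁ δ₂, by positivity, ?_⟩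
    rintro ⟨t, x⟩ ⟨ht, -⟩ ⟨s, y⟩ ⟨hs, -⟩ hd
    have e1 := h₁ (t, x) ⟨ht, mem_univ _⟩ (s, y) ⟨hs, mem_univ _⟩ (hd.trans_le (min_le_left _ _))
    have e2 := h₂ t ht s hs
      (((le_max_left _ _).trans_eq (Prod.dist_eq).symm).trans_lt (hd.trans_le (min_le_right _ _)))
    simp only [Real.dist_eq] at *
    rw [hW t ht, hW s hs, add_sub_add_right_eq_sub]
    have e3 : Real.exp (-(μ * t)) * (V t x - ε) - Real.exp (-(μ * s)) * (V s y - ε) =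
        Real.exp (-(μ * t)) * (V t x - V s y) +
          (Real.exp (-(μ * t)) - Real.exp (-(μ * s))) * (V s y - ε) := by ring
    rw [e3]
    refine (abs_add_le _ _).trans_lt ?_
    rw [abs_mul, abs_mul]
    have e4 : |Real.exp (-(μ * t))| * |V t x - V s y| < η / 2 := by
      have : |Real.exp (-(μ * t))| * |V t x - V s y| ≤ (|B| + 1) * |V t x - V s y| := by
        gcongr
        linarith [hBabs t ht]
      refine this.trans_lt ?_
      rw [lt_div_iff₀ (by positivity)] at e1
      linarith
    have e5 : |Real.exp (-(μ * t)) - Real.exp (-(μ * s))| * |V s y - ε| < η / 2 := by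
      have : |Real.exp (-(μ * t)) - Real.exp (-(μ * s))| * |V s y - ε| ≤
          |Real.exp (-(μ * t)) - Real.exp (-(μ * s))| * (|C| + |ε| + 1) := by
        gcongr
        linarith [hbd s hs y]
      refine this.trans_lt ?_
      rw [lt_div_iff₀ (by positivity)] at e2
      linarith
    linarith

lemma sub_mem_Icc_zero {t : ℝ} (ht : t ∈ Icc 0 T) : T - t ∈ Icc 0 T :=
  ⟨sub_nonneg.2 ht.2, sub_le_self T ht.1⟩

lemma IsBUC.timeReversal (hV : IsBUC T V) : IsBUC T fun τ x => V (T - τ) x := by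
  obtain ⟨⟨C, hC⟩, hVc⟩ := hV
  refine ⟨⟨C, fun t ht x => hC _ (sub_mem_Icc_zero ht) x⟩, ?_⟩
  have h : UniformContinuous fun q : ℝ × EuclideanSpace ℝ (Fin n) => (T - q.1, q.2) :=
    (uniformContinuous_const.sub uniformContinuous_fst).prodMk uniformContinuous_snd
  exact hVc.comp h.uniformContinuousOn fun q hq => ⟨sub_mem_Icc_zero hq.1, mem_univ _⟩

/-- Reversal maps the slab [0,T] × ℝⁿ to itself, so extrema relative to the slab correspond. -/
lemma tendsto_timeReversal (T t : ℝ) (x : EuclideanSpace ℝ (Fin n)) :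
    Filter.Tendsto (fun q : ℝ × EuclideanSpace ℝ (Fin n) => (T - q.1, q.2))
      (nhdsWithin (T - t, x) (Icc 0 T ×ˢ univ)) (nhdsWithin (t, x) (Icc 0 T ×ˢ univ)) := by
  have h : Continuous fun q : ℝ × EuclideanSpace ℝ (Fin n) => (T - q.1, q.2) := by fun_prop
  have h' := h.continuousWithinAt.tendsto_nhdsWithin (x := (T - t, x)) (s := Icc 0 T ×ˢ univ)
    (t := Icc 0 T ×ˢ univ) fun q hq => ⟨sub_mem_Icc_zero hq.1, mem_univ _⟩
  simpa using h'

lemma contDiff_timeReversal {φ : ℝ × EuclideanSpace ℝ (Fin n) → ℝ} (hφ : ContDiff ℝ 1 φ) (T : ℝ) :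
    ContDiff ℝ 1 fun q : ℝ × EuclideanSpace ℝ (Fin n) => φ (T - q.1, q.2) :=
  hφ.comp ((contDiff_const.sub contDiff_fst).prodMk contDiff_snd)

lemma IsViscositySolutionTerminal.timeReversal (hV : IsViscositySolutionTerminal T lam ε H I V)
    (hJ : ∀ τ ∈ J, T - τ ∈ I) :
    IsViscositySolutionInitial T lam ε (fun τ x p => H (T - τ) x p) J fun τ x => V (T - τ) x := by
  refine ⟨fun x => by simpa using hV.terminal x, fun φ hφ τ hτ x hmax => ?_,
    fun φ hφ τ hτ x hmin => ?_⟩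
  · have hloc : IsLocalMaxOn (fun q : ℝ × EuclideanSpace ℝ (Fin n) =>
        V q.1 q.2 - φ (T - q.1, q.2)) (Icc 0 T ×ˢ univ) (T - τ, x) := by
      filter_upwards [(tendsto_timeReversal T τ x).eventually hmax] with q hq
      simpa using hq
    have h := hV.subsolution _ (contDiff_timeReversal hφ T) (T - τ) (hJ τ hτ) x hloc
    simp only [sub_sub_cancel] at h
    rw [deriv_comp_const_sub (fun s => φ (s, x)), sub_sub_cancel] at h
    linarith
  · have hloc : IsLocalMinOn (fun q : ℝ × EuclideanSpace ℝ (Fin n) =>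
        V q.1 q.2 - φ (T - q.1, q.2)) (Icc 0 T ×ˢ univ) (T - τ, x) := by
      filter_upwards [(tendsto_timeReversal T τ x).eventually hmin] with q hq
      simpa using hq
    have h := hV.supersolution _ (contDiff_timeReversal hφ T) (T - τ) (hJ τ hτ) x hloc
    simp only [sub_sub_cancel] at h
    rw [deriv_comp_const_sub (fun s => φ (s, x)), sub_sub_cancel] at h
    linarith

lemma IsViscositySolutionInitial.timeReversal
    (hW : IsViscositySolutionInitial T lam ε (fun τ x p => H (T - τ) x p) J W)
    (hI : ∀ t ∈ I, T - t ∈ J) :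
    IsViscositySolutionTerminal T lam ε H I fun t x => W (T - t) x := by
  refine ⟨fun x => by simpa using hW.initial x, fun φ hφ t ht x hmax => ?_,
    fun φ hφ t ht x hmin => ?_⟩
  · have hloc : IsLocalMaxOn (fun q : ℝ × EuclideanSpace ℝ (Fin n) =>
        W q.1 q.2 - φ (T - q.1, q.2)) (Icc 0 T ×ˢ univ) (T - t, x) := by
      filter_upwards [(tendsto_timeReversal T t x).eventually hmax] with q hq
      simpa using hq
    have h := hW.subsolution _ (contDiff_timeReversal hφ T) (T - t) (hI t ht) x hloc
    simp only [sub_sub_cancel] at h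
    rw [deriv_comp_const_sub (fun s => φ (s, x)), sub_sub_cancel] at h
    linarith
  · have hloc : IsLocalMinOn (fun q : ℝ × EuclideanSpace ℝ (Fin n) =>
        W q.1 q.2 - φ (T - q.1, q.2)) (Icc 0 T ×ˢ univ) (T - t, x) := by
      filter_upwards [(tendsto_timeReversal T t x).eventually hmin] with q hq
      simpa using hq
    have h := hW.supersolution _ (contDiff_timeReversal hφ T) (T - t) (hI t ht) x hloc
    simp only [sub_sub_cancel] at h
    rw [deriv_comp_const_sub (fun s => φ (s, x)), sub_sub_cancel] at h
    linarith

end Transformations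

/-! ### Reduction of the discounted problem to the undiscounted one -/

section Reduction

variable {n m : ℕ} {T lam : ℝ} {U : Set (EuclideanSpace ℝ (Fin m))}
  {f : EuclideanSpace ℝ (Fin n) → EuclideanSpace ℝ (Fin m) → EuclideanSpace ℝ (Fin n)}
  {h : ℝ → EuclideanSpace ℝ (Fin n) → EuclideanSpace ℝ (Fin m) → ℝ}

/-- The dynamics as a function of controls in the subtype `U`. -/
def controlDyn (U : Set (EuclideanSpace ℝ (Fin m)))
    (f : EuclideanSpace ℝ (Fin n) → EuclideanSpace ℝ (Fin m) → EuclideanSpace ℝ (Fin n))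
    (x : EuclideanSpace ℝ (Fin n)) (a : U) : EuclideanSpace ℝ (Fin n) :=
  f x a

/-- The cost `e^{-λt} h(t,x,u)`, with time clamped to `[0,T]`. -/
def clampedCost (hT : 0 ≤ T) (lam : ℝ) (U : Set (EuclideanSpace ℝ (Fin m)))
    (h : ℝ → EuclideanSpace ℝ (Fin n) → EuclideanSpace ℝ (Fin m) → ℝ)
    (t : ℝ) (x : EuclideanSpace ℝ (Fin n)) (a : U) : ℝ :=
  Real.exp (-(lam * projIcc 0 T hT t)) * h (projIcc 0 T hT t) x a

lemma clampedCost_of_mem (hT : 0 ≤ T) {t : ℝ} (ht : t ∈ Icc 0 T) (x : EuclideanSpace ℝ (Fin n))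
    (a : U) : clampedCost hT lam U h t x a = Real.exp (-(lam * t)) * h t x a := by
  simp [clampedCost, projIcc_of_mem hT ht]

namespace StandingAssumptions

/-- The forward-shift modulus, applied with shift |s - t| from the earlier time; s = t is separate
because shifts are positive. -/
lemma exists_abs_cost_sub_le (hA : StandingAssumptions T U f h)
    {K : Set (EuclideanSpace ℝ (Fin n))} (hK : IsCompact K) {η : ℝ} (hη : 0 < η) :
    ∃ δ > 0, ∀ s ∈ Icc 0 T, ∀ t ∈ Icc 0 T, |s - t| < δ → ∀ x ∈ K, ∀ u ∈ U,
      |h s x u - h t x u| ≤ η := by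
  obtain ⟨δ, hδ, hreg⟩ := hA.cost_time_regular K hK η hη
  have key : ∀ s ∈ Icc 0 T, ∀ t ∈ Icc 0 T, s < t → |s - t| < δ → ∀ x ∈ K, ∀ u ∈ U,
      |h t x u - h s x u| ≤ η := by
    intro s hs t ht hst hd x hx u hu
    rw [abs_sub_comm, abs_of_pos (sub_pos.2 hst)] at hd
    have := hreg (t - s) ⟨sub_pos.2 hst, hd⟩ s ⟨hs.1, by linarith [ht.2]⟩ x hx u hu
    rwa [add_sub_cancel] at this
  refine ⟨δ, hδ, fun s hs t ht hd x hx u hu => ?_⟩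
  rcases lt_trichotomy s t with hst | rfl | hst
  · rw [abs_sub_comm]
    exact key s hs t ht hst hd x hx u hu
  · simpa using hη.le
  · rw [abs_sub_comm] at hd
    exact key t ht s hs hst hd x hx u hu

theorem exists_isControlSystem (hA : StandingAssumptions T U f h) (lam : ℝ) :
    ∃ M L, IsControlSystem (controlDyn U f) (clampedCost hA.horizon_pos.le lam U h) M L := by
  have hT := hA.horizon_pos.le
  obtain ⟨Lf, hLf, hfl⟩ := hA.dyn_lipschitz
  obtain ⟨Mf, hMf, hfb⟩ := hA.dyn_bounded
  obtain ⟨Lh, hLh, hhl⟩ := hA.cost_lipschitz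
  obtain ⟨Mh, hMh, hhb⟩ := hA.cost_bounded
  obtain ⟨B', hB'⟩ := isCompact_Icc.exists_bound_of_continuousOn (s := Icc 0 T)
    (f := fun t => Real.exp (-(lam * t))) (by fun_prop)
  obtain ⟨B, hB0, hB⟩ : ∃ B > 0, ∀ t ∈ Icc 0 T, |Real.exp (-(lam * t))| ≤ B :=
    ⟨|B'| + 1, by positivity, fun t ht => (hB' t ht).trans (by linarith [le_abs_self B'])⟩
  refine ⟨Mf + B * Mh, Lf + B * Lh, ?_, ?_, ?_, ?_, ?_, ?_, ?_, by positivity, by positivity⟩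
  -- Carathéodory's criterion: continuity in the state and measurability in the control give joint
  -- measurability.
  · refine measurable_uncurry_of_continuous_of_measurable (fun a => ?_) (fun x => ?_)
    · refine (LipschitzWith.of_dist_le_mul (K := Lf.toNNReal) fun x y => ?_).continuous
      rw [Real.coe_toNNReal _ hLf.le, dist_eq_norm, dist_eq_norm]
      exact hfl x y a a.2
    · exact (continuousOn_iff_continuous_domRestrict.1 (hA.dyn_continuous x)).measurable
  · intro x a
    have := hfb x a a.2
    have : 0 ≤ B * Mh := by positivity
    simp only [controlDyn]
    linarith
  · intro x y a
    refine (hfl x y a a.2).trans ?_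
    gcongr
    have : 0 ≤ B * Lh := by positivity
    linarith
  · have hp : Measurable fun p : ℝ × EuclideanSpace ℝ (Fin n) × U =>
        ((projIcc 0 T hT p.1, p.2.1, p.2.2) : Icc (0 : ℝ) T × EuclideanSpace ℝ (Fin n) × U) :=
      (continuous_projIcc.measurable.comp measurable_fst).prodMk
        (measurable_snd.fst.prodMk measurable_snd.snd)
    refine Measurable.mul ?_ (hA.cost_measurable.comp hp)
    have : Continuous fun t : ℝ => Real.exp (-(lam * (projIcc 0 T hT t : ℝ))) := by
      have : Continuous fun t : ℝ => (projIcc 0 T hT t : ℝ) :=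
        continuous_subtype_val.comp continuous_projIcc
      fun_prop
    exact this.measurable.comp measurable_fst
  · intro t x a
    rw [clampedCost, abs_mul]
    have h1 := hB _ (projIcc 0 T hT t).2
    have h2 := hhb _ (projIcc 0 T hT t).2 x a a.2
    have h3 := mul_le_mul h1 h2 (abs_nonneg _) hB0.le
    linarith
  · intro t x y a
    rw [clampedCost, clampedCost, ← mul_sub, abs_mul]
    have h1 := hB _ (projIcc 0 T hT t).2
    have h2 := hhl _ (projIcc 0 T hT t).2 x y a a.2
    have h3 := mul_le_mul h1 h2 (abs_nonneg _) hB0.le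
    have : 0 ≤ Lf * ‖x - y‖ := by positivity
    linarith
  · intro K hK η hη
    have hec : UniformContinuousOn (fun t => Real.exp (-(lam * t))) (Icc 0 T) :=
      isCompact_Icc.uniformContinuousOn_of_continuous (by fun_prop)
    -- The product e^{-λt} h is varied one factor at a time, with η/2 allotted to each.
    obtain ⟨δ₁, hδ₁, h₁⟩ := hA.exists_abs_cost_sub_le hK (η := η / (2 * B)) (by positivity)
    obtain ⟨δ₂, hδ₂, h₂⟩ := Metric.uniformContinuousOn_iff.1 hec (η / (2 * Mh)) (by positivity)
    refine ⟨min δ₁ δ₂, by positivity, fun s t hst x hx a => ?_⟩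
    have hs := (projIcc 0 T hT s).2
    have ht := (projIcc 0 T hT t).2
    have hst' := (abs_projIcc_sub_projIcc (h := hT) (c := s) (d := t)).trans_lt hst
    simp only [clampedCost]
    set s' : ℝ := (projIcc 0 T hT s : ℝ)
    set t' : ℝ := (projIcc 0 T hT t : ℝ)
    have e1 := h₁ s' hs t' ht (hst'.trans_le (min_le_left _ _)) x hx a a.2
    have e2 := h₂ s' hs t' ht (hst'.trans_le (min_le_right _ _))
    rw [Real.dist_eq] at e2
    have e3 := mul_le_mul (hB s' hs) e1 (abs_nonneg _) hB0.le
    have e4 := mul_le_mul e2.le (hhb t' ht x a a.2) (abs_nonneg _) (by positivity)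
    have e5 : B * (η / (2 * B)) = η / 2 := by field_simp
    have e6 : η / (2 * Mh) * Mh = η / 2 := by field_simp
    rw [← abs_mul] at e3 e4
    have e7 : Real.exp (-(lam * s')) * h s' x a - Real.exp (-(lam * t')) * h t' x a =
        Real.exp (-(lam * s')) * (h s' x a - h t' x a) +
          (Real.exp (-(lam * s')) - Real.exp (-(lam * t'))) * h t' x a := by ring
    rw [e7]
    refine (abs_add_le _ _).trans ?_
    linarith

lemma integral_clampedCost (hT : 0 ≤ T) {t : ℝ} (ht : t ∈ Icc 0 T)
    {u : ℝ → EuclideanSpace ℝ (Fin m)} {y y' : ℝ → EuclideanSpace ℝ (Fin n)} {u' : ℝ → U}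
    (hu : ∀ s ∈ Icc t T, (u' s : EuclideanSpace ℝ (Fin m)) = u s)
    (hy : ∀ s ∈ Icc t T, y' s = y s) :
    ∫ s in t..T, clampedCost hT lam U h s (y' s) (u' s) =
      Real.exp (-(lam * t)) * discountedCost T lam h t u y := by
  rw [discountedCost, ← intervalIntegral.integral_const_mul]
  refine intervalIntegral.integral_congr fun s hs => ?_
  rw [uIcc_of_le ht.2] at hs
  rw [clampedCost_of_mem hT ⟨ht.1.trans hs.1, hs.2⟩, hu s hs, hy s hs, ← mul_assoc,
    ← Real.exp_add]
  congr 2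
  ring

/-- `e^{-λt} V_λ(t,x)` is the value of the undiscounted problem with cost `e^{-λt} h`. -/
theorem mildValue_eq (hA : StandingAssumptions T U f h) {t : ℝ} (ht : t ∈ Icc 0 T)
    (x : EuclideanSpace ℝ (Fin n)) :
    mildValue (controlDyn U f) (clampedCost hA.horizon_pos.le lam U h) T t x =
      Real.exp (-(lam * t)) * discountedValue T lam U f h t x := by
  obtain ⟨M, L, hS⟩ := hA.exists_isControlSystem lam
  rw [discountedValue, ← smul_eq_mul, ← Real.sInf_smul_of_nonneg (Real.exp_pos _).le, mildValue]
  congr 1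
  ext J
  rw [mem_smul_set]
  constructor
  · rintro ⟨u, y, hu, hy, rfl⟩
    refine ⟨_, ⟨fun s => u s, y, ⟨?_, fun s _ => (u s).2⟩, ⟨hy.1.continuousOn, fun s hs =>
      ⟨hS.dyn_intervalIntegrable hu hy.1 t s, hy.2 s hs⟩⟩, rfl⟩, ?_⟩
    · exact measurable_subtype_coe.comp (hu.comp measurable_subtype_coe)
    · exact (integral_clampedCost hA.horizon_pos.le ht (fun _ _ => rfl) fun _ _ => rfl).symm
  · rintro ⟨_, ⟨u, y, ⟨hum, huU⟩, ⟨hyc, hy⟩, rfl⟩, rfl⟩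
    -- Freezing time at the endpoints extends control and trajectory to ℝ, keeping measurability,
    -- values in U and continuity.
    have hproj : ∀ s ∈ Icc t T, (projIcc t T ht.2 s : ℝ) = s := fun s hs => by
      rw [projIcc_of_mem ht.2 hs]
    refine ⟨fun s => ⟨u (projIcc t T ht.2 s), huU _ (projIcc t T ht.2 s).2⟩,
      fun s => y (projIcc t T ht.2 s), ?_, ⟨?_, fun s hs => ?_⟩, ?_⟩
    · exact (hum.comp continuous_projIcc.measurable).subtype_mk
    · exact (continuousOn_iff_continuous_domRestrict.1 hyc).comp continuous_projIcc
    · simp only [hproj s hs]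
      rw [(hy s hs).2]
      congr 1
      refine intervalIntegral.integral_congr fun r hr => ?_
      rw [uIcc_of_le hs.1] at hr
      simp only [controlDyn, hproj r ⟨hr.1, hr.2.trans hs.2⟩]
    · refine (integral_clampedCost hA.horizon_pos.le ht ?_ ?_).symm
      · intro s hs
        simp only [hproj s hs]
      · intro s hs
        simp only [hproj s hs]

/-- This is the relation between Hamiltonians that `exp_mul` requires with μ = λ. -/
lemma mildHamiltonian_eq (hA : StandingAssumptions T U f h) {t : ℝ} (ht : t ∈ Icc 0 T)
    (x p : EuclideanSpace ℝ (Fin n)) :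
    mildHamiltonian (controlDyn U f) (clampedCost hA.horizon_pos.le lam U h) t x p =
      Real.exp (-(lam * t)) * hamiltonian U f h t x (Real.exp (lam * t) • p) := by
  rw [hamiltonian, Real.mul_iInf_of_nonneg (Real.exp_pos _).le, mildHamiltonian]
  congr 1
  ext a
  rw [clampedCost_of_mem _ ht, inner_smul_left, mul_add, ← mul_assoc (Real.exp _) _ (inner ℝ p _)]
  simp only [conj_trivial]
  rw [← Real.exp_add, neg_add_cancel, Real.exp_zero, one_mul]
  rfl

/-- Written in the shape `exp_mul` expects, with μ = -λ and old terminal value 0. -/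
lemma shiftedValue_eq (hA : StandingAssumptions T U f h) (ε : ℝ) {t : ℝ} (ht : t ∈ Icc 0 T)
    (x : EuclideanSpace ℝ (Fin n)) :
    shiftedValue T lam ε U f h t x = Real.exp (-(-lam * t)) *
      (mildValue (controlDyn U f) (clampedCost hA.horizon_pos.le lam U h) T t x - 0) + ε := by
  rw [hA.mildValue_eq ht, shiftedValue, sub_zero, ← mul_assoc, ← Real.exp_add]
  simp

theorem isBUC_shiftedValue (hA : StandingAssumptions T U f h) (lam ε : ℝ) :
    IsBUC T (shiftedValue T lam ε U f h) := by
  have := hA.control_nonempty.to_subtype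
  obtain ⟨M, L, hS⟩ := hA.exists_isControlSystem lam
  exact (hS.isBUC_mildValue hA.horizon_pos.le).exp_mul (-lam) 0 ε fun t ht x =>
    hA.shiftedValue_eq ε ht x

theorem isViscositySolutionTerminal_shiftedValue (hA : StandingAssumptions T U f h) (lam ε : ℝ) :
    IsViscositySolutionTerminal T lam ε (hamiltonian U f h) (Ico 0 T)
      (shiftedValue T lam ε U f h) := by
  have := hA.control_nonempty.to_subtype
  obtain ⟨M, L, hS⟩ := hA.exists_isControlSystem lam
  have key := (hS.isViscositySolutionTerminal_mildValue (T := T)).exp_mul hA.horizon_pos.le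
    Ico_subset_Icc_self (-lam) ε (H' := hamiltonian U f h) ?_ fun t ht x =>
      hA.shiftedValue_eq ε ht x
  · simpa using key
  · intro t ht x p
    rw [hA.mildHamiltonian_eq (Ico_subset_Icc_self ht), smul_smul, ← mul_assoc, ← Real.exp_add,
      ← Real.exp_add]
    simp

/-- Here `exp_mul` runs backwards: e^{-λt}(V - ε) solves the undiscounted problem and so equals its
value; the exponential then cancels. -/
theorem eq_shiftedValue (hA : StandingAssumptions T U f h) {ε : ℝ}
    {V : ℝ → EuclideanSpace ℝ (Fin n) → ℝ} (hV : IsBUC T V)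
    (hVs : IsViscositySolutionTerminal T lam ε (hamiltonian U f h) (Ioo 0 T) V) :
    ∀ t ∈ Icc 0 T, ∀ x, V t x = shiftedValue T lam ε U f h t x := by
  have := hA.control_nonempty.to_subtype
  obtain ⟨M, L, hS⟩ := hA.exists_isControlSystem lam
  intro t ht x
  have h1 := hVs.exp_mul hA.horizon_pos.le Ioo_subset_Icc_self lam 0
    (W := fun t x => Real.exp (-(lam * t)) * (V t x - ε) + 0)
    (fun t ht x p => hA.mildHamiltonian_eq (Ioo_subset_Icc_self ht) x p) fun _ _ _ => rfl
  rw [sub_self] at h1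
  have h2 := hS.eq_mildValue hA.horizon_pos (hV.exp_mul lam ε 0 fun _ _ _ => rfl) h1 t ht x
  rw [hA.mildValue_eq ht, add_zero] at h2
  rw [shiftedValue, ← mul_left_cancel₀ (Real.exp_pos _).ne' h2, sub_add_cancel]

end StandingAssumptions

end Reduction

end ShiftedHJB

end

/-- The shifted value `V_ε` is the unique bounded uniformly continuous viscosity solution of the
terminal value problem with offset `λ ε`, and `W_ε(τ,x) = V_ε(T-τ,x)` that of the forward problem
with the time-reversed Hamiltonian. Both statements hold for each of the two usual conventions on
where the equation is tested: at interior times only, or also at the free end of the interval. -/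
theorem theorem2 (n m : ℕ) (T lam ε : ℝ) (U : Set (EuclideanSpace ℝ (Fin m)))
    (f : EuclideanSpace ℝ (Fin n) → EuclideanSpace ℝ (Fin m) → EuclideanSpace ℝ (Fin n))
    (h : ℝ → EuclideanSpace ℝ (Fin n) → EuclideanSpace ℝ (Fin m) → ℝ)
    (hA : ShiftedHJB.StandingAssumptions T U f h) :
    (∀ I : Set ℝ, I = Set.Ioo 0 T ∨ I = Set.Ico 0 T →
      (ShiftedHJB.IsBUC T (ShiftedHJB.shiftedValue T lam ε U f h) ∧
        ShiftedHJB.IsViscositySolutionTerminal T lam ε (ShiftedHJB.hamiltonian U f h) I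
          (ShiftedHJB.shiftedValue T lam ε U f h)) ∧
      ∀ V : ℝ → EuclideanSpace ℝ (Fin n) → ℝ, ShiftedHJB.IsBUC T V →
        ShiftedHJB.IsViscositySolutionTerminal T lam ε (ShiftedHJB.hamiltonian U f h) I V →
        ∀ t ∈ Set.Icc 0 T, ∀ x, V t x = ShiftedHJB.shiftedValue T lam ε U f h t x) ∧
    (∀ I : Set ℝ, I = Set.Ioo 0 T ∨ I = Set.Ioc 0 T →
      (ShiftedHJB.IsBUC T (fun τ x => ShiftedHJB.shiftedValue T lam ε U f h (T - τ) x) ∧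
        ShiftedHJB.IsViscositySolutionInitial T lam ε
          (fun τ x p => ShiftedHJB.hamiltonian U f h (T - τ) x p) I
          (fun τ x => ShiftedHJB.shiftedValue T lam ε U f h (T - τ) x)) ∧
      ∀ W : ℝ → EuclideanSpace ℝ (Fin n) → ℝ, ShiftedHJB.IsBUC T W →
        ShiftedHJB.IsViscositySolutionInitial T lam ε
          (fun τ x p => ShiftedHJB.hamiltonian U f h (T - τ) x p) I W →
        ∀ τ ∈ Set.Icc 0 T, ∀ x, W τ x = ShiftedHJB.shiftedValue T lam ε U f h (T - τ) x) := by
  refine ⟨fun I hI => ?_, fun I hI => ?_⟩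
  -- Testing on a larger set is a stronger condition: uniqueness is drawn from (0,T) and existence
  -- from [0,T).
  · have hsub : Set.Ioo 0 T ⊆ I := by
      rcases hI with rfl | rfl
      exacts [subset_rfl, Set.Ioo_subset_Ico_self]
    have hsup : I ⊆ Set.Ico 0 T := by
      rcases hI with rfl | rfl
      exacts [Set.Ioo_subset_Ico_self, subset_rfl]
    exact ⟨⟨hA.isBUC_shiftedValue lam ε,
      (hA.isViscositySolutionTerminal_shiftedValue lam ε).mono hsup⟩,
      fun V hV hVs => hA.eq_shiftedValue hV (hVs.mono hsub)⟩
  · have hsub : ∀ t ∈ Set.Ioo 0 T, T - t ∈ I := by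
      rintro t ⟨ht0, htT⟩
      rcases hI with rfl | rfl
      exacts [⟨by linarith, by linarith⟩, ⟨by linarith, by linarith⟩]
    have hsup : ∀ τ ∈ I, T - τ ∈ Set.Ico 0 T := by
      intro τ hτ
      rcases hI with rfl | rfl
      · exact ⟨by linarith [hτ.2], by linarith [hτ.1]⟩
      · exact ⟨by linarith [hτ.2], by linarith [hτ.1]⟩
    refine ⟨⟨(hA.isBUC_shiftedValue lam ε).timeReversal,
      (hA.isViscositySolutionTerminal_shiftedValue lam ε).timeReversal hsup⟩,
      fun W hW hWs τ hτ x => ?_⟩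
    have h := hA.eq_shiftedValue hW.timeReversal (hWs.timeReversal hsub) (T - τ)
      (ShiftedHJB.sub_mem_Icc_zero hτ) x
    simpa using h
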